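/- Let $(\Sigma,h)$ be a smooth Riemannian manifold which is connected, Hausdorff, second countable, without boundary and of dimension $n\ge 2$. Call $\Sigma$ \emph{convex} if any two points $x,y\in\Sigma$ are joined by a minimizing geodesic, i.e. by a geodesic segment (possibly constant, when $x=y$) whose length equals the Riemannian distance $d^h(x,y)$. Let $M=\mathbb{R}\times\Sigma$ be the static spacetime with Lorentzian metric $g=-dt^2+h$, time oriented by $\partial_t$. Let $J\subset M\times M$ be its causal relation: $(p,q)\in J$ if and only if $p=q$ or there is a future-directed causal curve from $p$ to $q$, where causal curves are piecewise $C^1$ with nowhere vanishing causal (timelike or null) one-sided velocities. Call $M$ \emph{causally simple} if it has no closed causal curve and $J$ is a closed subset of $M\times M$. Then $\Sigma$ is convex if and only if $M$ is causally simple. -/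

import Mathlib

open Set Bundle
open scoped Manifold ContDiff Topology

noncomputable section

section Riemannian

/-! ### Riemannian manifolds: geodesics, minimizing geodesics, convexity

The Riemannian metric `h` on the manifold `M` is the inner product carried by the tangent
spaces of `M`. -/

variable {n : ℕ} {M : Type*} [TopologicalSpace M] [ChartedSpace (EuclideanSpace ℝ (Fin n)) M]
  [IsManifold (𝓡 n) ∞ M] [RiemannianBundle (fun x : M ↦ TangentSpace (𝓡 n) x)]

/-- The Riemannian metric read in the chart `φ` at `p`: for a point `u` of the target of `φ`,
this is `h (dφ⁻¹ v, dφ⁻¹ w)` at the point `φ⁻¹ u`. For `v = eᵢ`, `w = eⱼ`, it is `hᵢⱼ(u)`. -/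
def metricInChart (p : M) (u v w : EuclideanSpace ℝ (Fin n)) : ℝ :=
  inner ℝ
    (mfderiv 𝓘(ℝ, EuclideanSpace ℝ (Fin n)) (𝓡 n) (extChartAt (𝓡 n) p).symm u v)
    (mfderiv 𝓘(ℝ, EuclideanSpace ℝ (Fin n)) (𝓡 n) (extChartAt (𝓡 n) p).symm u w)

/-- The Christoffel symbols of the first kind of the Levi-Civita connection in the chart at `p`,
as a trilinear form in `v, w, z`: for `v = eᵢ`, `w = eⱼ`, `z = eₖ`, this is
`Γ_{ij,k} = (∂ᵢ hⱼₖ + ∂ⱼ hᵢₖ - ∂ₖ hᵢⱼ) / 2 = ∑ₗ hₖₗ Γˡᵢⱼ`. -/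
def christoffelInChart (p : M) (u v w z : EuclideanSpace ℝ (Fin n)) : ℝ :=
  (fderiv ℝ (fun u' ↦ metricInChart p u' w z) u v
    + fderiv ℝ (fun u' ↦ metricInChart p u' v z) u w
    - fderiv ℝ (fun u' ↦ metricInChart p u' v w) u z) / 2

/-- `σ` restricted to the interval `[a, b]` (with `a < b`) is a geodesic of the Riemannian
manifold: it is `C²` (hence automatically smooth, as the metric is) and it solves the geodesic
equation `∇_{σ'} σ' = 0`. The equation is written at each time `s` in the chart at `σ s`, with the index lowered: with `c = φ ∘ σ`,
`∑ₗ hₖₗ c''ˡ + ∑ᵢⱼ Γ_{ij,k} c'ⁱ c'ʲ = 0` for all `k`. The derivatives are one-sided at the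
endpoints. -/
structure IsGeodesicOn (σ : ℝ → M) (a b : ℝ) : Prop where
  lt : a < b
  contMDiffOn : ContMDiffOn 𝓘(ℝ, ℝ) (𝓡 n) 2 σ (Icc a b)
  geodesic_eq : ∀ s ∈ Icc a b,
    let c : ℝ → EuclideanSpace ℝ (Fin n) := fun r ↦ extChartAt (𝓡 n) (σ s) (σ r)
    let c' : ℝ → EuclideanSpace ℝ (Fin n) := derivWithin c (Icc a b)
    let c'' : ℝ → EuclideanSpace ℝ (Fin n) := derivWithin c' (Icc a b)
    ∀ z : EuclideanSpace ℝ (Fin n),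
      metricInChart (σ s) (c s) (c'' s) z + christoffelInChart (σ s) (c s) (c' s) (c' s) z = 0

/-- A minimizing geodesic: a geodesic segment whose length equals the Riemannian distance
between its endpoints. -/
structure IsMinimizingGeodesicOn (σ : ℝ → M) (a b : ℝ) : Prop where
  isGeodesicOn : IsGeodesicOn (n := n) σ a b
  length_eq : Manifold.pathELength (𝓡 n) σ a b = Manifold.riemannianEDist (𝓡 n) (σ a) (σ b)

variable (n M) in
/-- A Riemannian manifold is convex if any two of its points are joined by a minimizing
geodesic. -/
def IsConvexRiemannian : Prop :=
  ∀ x y : M, ∃ (σ : ℝ → M) (a b : ℝ),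
    σ a = x ∧ σ b = y ∧ IsMinimizingGeodesicOn (n := n) σ a b

end Riemannian

section Lorentzian

/-! ### Spacetimes and their causality -/

variable {E : Type*} [NormedAddCommGroup E] [NormedSpace ℝ E]
  {H : Type*} [TopologicalSpace H] (I : ModelWithCorners ℝ E H)
  (M : Type*) [TopologicalSpace M] [ChartedSpace H M] [IsManifold I ∞ M]

/-- A smooth Lorentzian metric, of signature `(-, +, …, +)`, on a finite-dimensional manifold. -/
structure LorentzianMetric where
  /-- The bilinear form on each tangent space. -/
  form : ∀ p : M, LinearMap.BilinForm ℝ (TangentSpace I p)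
  symm : ∀ (p : M) (v w : TangentSpace I p), form p v w = form p w v
  /-- Each tangent space contains a vector on which the form is negative, and the form is
  positive definite on the orthogonal complement of that vector. -/
  signature : ∀ p : M, ∃ e : TangentSpace I p, form p e e < 0 ∧
    ∀ v : TangentSpace I p, form p e v = 0 → v ≠ 0 → 0 < form p v v
  /-- `g (X, Y)` is smooth wherever the vector fields `X` and `Y` are. -/
  smooth : ∀ (X Y : ∀ p : M, TangentSpace I p) (p : M),
    ContMDiffAt I I.tangent ∞ (fun q ↦ (⟨q, X q⟩ : TangentBundle I M)) p →
    ContMDiffAt I I.tangent ∞ (fun q ↦ (⟨q, Y q⟩ : TangentBundle I M)) p →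
    ContMDiffAt I 𝓘(ℝ, ℝ) ∞ (fun q ↦ form q (X q) (Y q)) p

/-- A time oriented Lorentzian metric: the time orientation is given by a smooth timelike
vector field, which is declared to be future-directed. -/
structure SpacetimeMetric extends LorentzianMetric I M where
  /-- The vector field defining the time orientation. -/
  timeField : ∀ p : M, TangentSpace I p
  smooth_timeField : ContMDiff I I.tangent ∞ (fun p ↦ (⟨p, timeField p⟩ : TangentBundle I M))
  timelike_timeField : ∀ p : M, form p (timeField p) (timeField p) < 0

namespace SpacetimeMetric

variable {I M}
variable (g : SpacetimeMetric I M)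

/-- A tangent vector is future-directed causal if it is non-zero, timelike or null, and in the
same time cone as the vector field defining the time orientation. -/
def IsFutureCausal {p : M} (v : TangentSpace I p) : Prop :=
  v ≠ 0 ∧ g.form p v v ≤ 0 ∧ g.form p (g.timeField p) v < 0

/-- `γ` restricted to `[a, b]` (with `a < b`) is a `C¹` curve whose velocity is everywhere
future-directed causal (one-sided derivatives are used at the endpoints). -/
structure IsFutureCausalC1On (γ : ℝ → M) (a b : ℝ) : Prop where
  lt : a < b
  contMDiffOn : ContMDiffOn 𝓘(ℝ, ℝ) I 1 γ (Icc a b)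
  causal : ∀ s ∈ Icc a b,
    g.IsFutureCausal (mfderivWithin 𝓘(ℝ, ℝ) I γ (Icc a b) s (1 : ℝ))

/-- `γ` restricted to `[a, b]` is a future-directed causal curve: it is piecewise `C¹`, that is
for some subdivision `a = τ 0 < ⋯ < τ k = b`, `k ≥ 1`, it is a `C¹` future-directed causal curve
on each `[τ i, τ (i + 1)]`. -/
def IsFutureCausalCurve (γ : ℝ → M) (a b : ℝ) : Prop :=
  ∃ (k : ℕ) (τ : ℕ → ℝ), 0 < k ∧ τ 0 = a ∧ τ k = b ∧
    ∀ i < k, g.IsFutureCausalC1On γ (τ i) (τ (i + 1))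

/-- The causal relation `J`: pairs `(p, q)` such that `p = q` or there is a future-directed
causal curve from `p` to `q`. -/
def causalRelation : Set (M × M) :=
  {pq | pq.1 = pq.2 ∨
    ∃ (γ : ℝ → M) (a b : ℝ), g.IsFutureCausalCurve γ a b ∧ γ a = pq.1 ∧ γ b = pq.2}

/-- A spacetime is causal if it has no closed causal curve. -/
def IsCausal : Prop :=
  ¬ ∃ (γ : ℝ → M) (a b : ℝ), g.IsFutureCausalCurve γ a b ∧ γ a = γ b

/-- A spacetime is causally simple if it is causal and its causal relation is closed. -/
def IsCausallySimple : Prop :=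
  g.IsCausal ∧ IsClosed g.causalRelation

end SpacetimeMetric

end Lorentzian

section Static

variable {n : ℕ} {S : Type*} [TopologicalSpace S] [ChartedSpace (EuclideanSpace ℝ (Fin n)) S]

/-- The differential `dt` at `p` of the first projection of `ℝ × S`. -/
def dTime (p : ℝ × S) : TangentSpace (𝓘(ℝ, ℝ).prod (𝓡 n)) p →ₗ[ℝ] ℝ :=
  (mfderiv (𝓘(ℝ, ℝ).prod (𝓡 n)) 𝓘(ℝ, ℝ) (Prod.fst : ℝ × S → ℝ) p).toLinearMap

/-- The differential at `p` of the second projection of `ℝ × S`. -/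
def dSpace (p : ℝ × S) :
    TangentSpace (𝓘(ℝ, ℝ).prod (𝓡 n)) p →ₗ[ℝ] TangentSpace (𝓡 n) p.2 :=
  (mfderiv (𝓘(ℝ, ℝ).prod (𝓡 n)) (𝓡 n) (Prod.snd : ℝ × S → S) p).toLinearMap

theorem dTime_apply (p : ℝ × S) (v : TangentSpace (𝓘(ℝ, ℝ).prod (𝓡 n)) p) :
    dTime p v = (show ℝ × EuclideanSpace ℝ (Fin n) from v).1 := by
  rw [dTime, mfderiv_fst]; rfl

theorem dSpace_apply (p : ℝ × S) (v : TangentSpace (𝓘(ℝ, ℝ).prod (𝓡 n)) p) :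
    dSpace p v = (show ℝ × EuclideanSpace ℝ (Fin n) from v).2 := by
  rw [dSpace, mfderiv_snd]; rfl

/-- The vector field `∂_t` on `ℝ × S`: the velocity of the curves `s ↦ (s, x)`. -/
def staticTimeField (p : ℝ × S) : TangentSpace (𝓘(ℝ, ℝ).prod (𝓡 n)) p :=
  ((1 : ℝ), (0 : EuclideanSpace ℝ (Fin n)))

theorem dTime_staticTimeField (p : ℝ × S) : dTime p (staticTimeField (n := n) p) = 1 := by
  rw [dTime_apply]; rfl

theorem dSpace_staticTimeField (p : ℝ × S) : dSpace p (staticTimeField (n := n) p) = 0 := by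
  rw [dSpace_apply]; rfl

theorem contMDiff_staticTimeField [IsManifold (𝓡 n) ∞ S] :
    ContMDiff (𝓘(ℝ, ℝ).prod (𝓡 n)) (𝓘(ℝ, ℝ).prod (𝓡 n)).tangent ∞
      (fun p : ℝ × S ↦
        (⟨p, staticTimeField p⟩ : TangentBundle (𝓘(ℝ, ℝ).prod (𝓡 n)) (ℝ × S))) := by
  have h1 : ContMDiff 𝓘(ℝ, ℝ) 𝓘(ℝ, ℝ).tangent ∞
      (fun t : ℝ ↦ (⟨t, (1 : ℝ)⟩ : TangentBundle 𝓘(ℝ, ℝ) ℝ)) :=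
    contMDiff_vectorSpace_iff_contDiff.2 contDiff_const
  have h0 : ContMDiff (𝓡 n) (𝓡 n).tangent ∞
      (zeroSection (EuclideanSpace ℝ (Fin n)) (TangentSpace (𝓡 n) : S → Type _)) :=
    contMDiff_zeroSection _ _
  exact (contMDiff_equivTangentBundleProd_symm (I := 𝓘(ℝ, ℝ)) (I' := 𝓡 n) (M := ℝ) (M' := S)).comp
    ((h1.comp contMDiff_fst).prodMk (h0.comp contMDiff_snd))

/-- The bilinear form `-dt² + h` on the tangent space of `ℝ × S` at `p`, where `h` is pulled
back by the second projection. -/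
def staticForm [RiemannianBundle (fun x : S ↦ TangentSpace (𝓡 n) x)] (p : ℝ × S) :
    LinearMap.BilinForm ℝ (TangentSpace (𝓘(ℝ, ℝ).prod (𝓡 n)) p) :=
  (innerₗ (TangentSpace (𝓡 n) p.2)).compl₁₂ (dSpace p) (dSpace p)
    - (LinearMap.mul ℝ ℝ).compl₁₂ (dTime p) (dTime p)

theorem staticForm_apply [RiemannianBundle (fun x : S ↦ TangentSpace (𝓡 n) x)] (p : ℝ × S)
    (v w : TangentSpace (𝓘(ℝ, ℝ).prod (𝓡 n)) p) :
    staticForm p v w = -(dTime p v * dTime p w) + inner ℝ (dSpace p v) (dSpace p w) :=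
  (sub_eq_add_neg _ _).trans (add_comm _ _)

variable (n S) in
/-- The static spacetime `ℝ × S` with metric `-dt² + h`, time oriented by `∂_t`. -/
def staticSpacetime [IsManifold (𝓡 n) ∞ S]
    [RiemannianBundle (fun x : S ↦ TangentSpace (𝓡 n) x)]
    [IsContMDiffRiemannianBundle (𝓡 n) ∞ (EuclideanSpace ℝ (Fin n))
      (fun x : S ↦ TangentSpace (𝓡 n) x)] :
    SpacetimeMetric (𝓘(ℝ, ℝ).prod (𝓡 n)) (ℝ × S) where
  form := staticForm
  symm p v w := by
    rw [staticForm_apply, staticForm_apply, mul_comm, real_inner_comm]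
  signature p := by
    refine ⟨staticTimeField p, ?_, fun v hv hv0 ↦ ?_⟩
    · rw [staticForm_apply, dTime_staticTimeField, dSpace_staticTimeField]
      simp
    · rw [staticForm_apply, dTime_staticTimeField, dSpace_staticTimeField,
        inner_zero_left, one_mul, add_zero, neg_eq_zero] at hv
      rw [staticForm_apply, hv, mul_zero, neg_zero, zero_add]
      refine real_inner_self_pos.2 fun h0 ↦ hv0 ?_
      rw [dTime_apply] at hv
      rw [dSpace_apply] at h0
      exact Prod.ext hv h0
  smooth X Y p hX hY := by
    have ht : ∀ Z : (∀ q : ℝ × S, TangentSpace (𝓘(ℝ, ℝ).prod (𝓡 n)) q),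
        ContMDiffAt (𝓘(ℝ, ℝ).prod (𝓡 n)) (𝓘(ℝ, ℝ).prod (𝓡 n)).tangent ∞
          (fun q ↦ (⟨q, Z q⟩ : TangentBundle (𝓘(ℝ, ℝ).prod (𝓡 n)) (ℝ × S))) p →
        ContMDiffAt (𝓘(ℝ, ℝ).prod (𝓡 n)) 𝓘(ℝ, ℝ) ∞ (fun q ↦ dTime q (Z q)) p := by
      intro Z hZ
      have h1 : ContMDiff (𝓘(ℝ, ℝ).prod (𝓡 n)).tangent 𝓘(ℝ, ℝ).tangent ∞
          (tangentMap (𝓘(ℝ, ℝ).prod (𝓡 n)) 𝓘(ℝ, ℝ) (Prod.fst : ℝ × S → ℝ)) :=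
        (contMDiff_fst (n := ∞)).contMDiff_tangentMap le_rfl
      exact (contMDiff_snd_tangentBundle_modelSpace ℝ 𝓘(ℝ, ℝ)).contMDiffAt.comp p
        (h1.contMDiffAt.comp p hZ)
    have hs : ∀ Z : (∀ q : ℝ × S, TangentSpace (𝓘(ℝ, ℝ).prod (𝓡 n)) q),
        ContMDiffAt (𝓘(ℝ, ℝ).prod (𝓡 n)) (𝓘(ℝ, ℝ).prod (𝓡 n)).tangent ∞
          (fun q ↦ (⟨q, Z q⟩ : TangentBundle (𝓘(ℝ, ℝ).prod (𝓡 n)) (ℝ × S))) p →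
        ContMDiffAt (𝓘(ℝ, ℝ).prod (𝓡 n)) (𝓡 n).tangent ∞
          (fun q ↦ (⟨q.2, dSpace q (Z q)⟩ : TangentBundle (𝓡 n) S)) p := by
      intro Z hZ
      have h1 : ContMDiff (𝓘(ℝ, ℝ).prod (𝓡 n)).tangent (𝓡 n).tangent ∞
          (tangentMap (𝓘(ℝ, ℝ).prod (𝓡 n)) (𝓡 n) (Prod.snd : ℝ × S → S)) :=
        (contMDiff_snd (n := ∞)).contMDiff_tangentMap le_rfl
      exact h1.contMDiffAt.comp p hZ
    have key := ((ht X hX).mul (ht Y hY)).neg.add ((hs X hX).inner_bundle (hs Y hY))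
    exact key.congr_of_eventuallyEq (Filter.Eventually.of_forall fun q ↦ staticForm_apply q _ _)
  timeField := staticTimeField
  smooth_timeField := contMDiff_staticTimeField
  timelike_timeField p := by
    rw [staticForm_apply, dTime_staticTimeField, dSpace_staticTimeField]
    simp

end Static

end

/-!
The causal relation `J` of the static spacetime is compared with the set
`{((t₀, x), (t₁, y)) | d(x, y) ≤ t₁ - t₀}`, where `d` is the Riemannian distance. A causal curve has
`‖σ'‖ ≤ t'` and `0 < t'` for its components `t` and `σ`
(`isFutureCausalC1On_static_iff`), so the time strictly increases, there is no closed causal curve,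
and `J` is contained in this set. Conversely, a curve `σ` of length less than `t₁ - t₀` lifts to a
causal curve, by taking for time function the arc length plus a linear term
(`mem_causalRelation_of_pathELength_le`). Only the boundary case `d(x, y) = t₁ - t₀` is at stake.

If `S` is convex, a minimizing geodesic between distinct points at distance `t₁ - t₀` has constant
nonzero speed, so it lifts to a null curve from time `t₀` to time `t₁`;
therefore `J` is equal to the above set, which is closed since `d` is continuous
(`mem_causalRelation_iff_of_isConvexRiemannian`).

If `J` is closed, then `((0, x), (d(x, y), y))` belongs to `J`, as a limit of points of `J`. The
space component of a corresponding causal curve, parametrized by time, is a piecewise `C¹` curve of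
speed at most one whose duration is the distance between its endpoints. The regularity of such
curves is the main part of the proof; no exponential map is needed. Speeds satisfy
`x ≤ (1 + x²) / 2`, hence in a chart such a curve minimizes the energy `∫ G(c)(c', c')` among broken
curves with the same endpoints (`geodesic_eq_of_minimizing_in_chart`). By the first variation
formula and the du Bois-Reymond lemma on the two sides of a possible corner, the momentum
`G(c) c'` is a primitive of a continuous function, in particular it is continuous at the corner
(`contDiffOn_two_of_energy_min`). Inverting the metric, the curve is `C²`, without corner
(`IsSubunitOn.union`), and satisfies the geodesic equation (`IsSubunitOn.isMinimizingGeodesicOn`).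
-/

/-! ### Calculus of variations on an interval -/

section Analysis

open MeasureTheory intervalIntegral Filter
open scoped Interval

/-- A function which is `C¹` on `[a, b]` extends to a `C¹` function on the line, whose derivative is
constant on each side of `[a, b]`. -/
theorem exists_contDiff_eqOn_Icc {F : Type*} [NormedAddCommGroup F] [NormedSpace ℝ F]
    [CompleteSpace F] {f : ℝ → F} {a b : ℝ} (hab : a < b) (hf : ContDiffOn ℝ 1 f (Icc a b)) :
    ∃ g : ℝ → F, ContDiff ℝ 1 g ∧ EqOn g f (Icc a b) ∧
      ∀ s, deriv g s = derivWithin f (Icc a b) (projIcc a b hab.le s) := by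
  have hc : ContinuousOn (derivWithin f (Icc a b)) (Icc a b) :=
    hf.continuousOn_derivWithin (uniqueDiffOn_Icc hab) le_rfl
  set v : ℝ → F := fun s ↦ derivWithin f (Icc a b) (projIcc a b hab.le s) with hv
  have hvc : Continuous v :=
    hc.comp_continuous (continuous_subtype_val.comp continuous_projIcc) fun s ↦
      (projIcc a b hab.le s).2
  have hd : ∀ s, HasDerivAt (fun s ↦ f a + ∫ r in a..s, v r) (v s) s := fun s ↦
    (hvc.integral_hasStrictDerivAt a s).hasDerivAt.const_add _
  refine ⟨fun s ↦ f a + ∫ r in a..s, v r, ?_, ?_, fun s ↦ (hd s).deriv⟩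
  · rw [contDiff_one_iff_deriv]
    refine ⟨fun s ↦ (hd s).differentiableAt, ?_⟩
    rw [show deriv (fun s ↦ f a + ∫ r in a..s, v r) = v from funext fun s ↦ (hd s).deriv]
    exact hvc
  · have hdf : DifferentiableOn ℝ f (Icc a b) := hf.differentiableOn one_ne_zero
    refine eq_of_derivWithin_eq (fun s _ ↦ (hd s).differentiableAt.differentiableWithinAt) hdf
      (fun s hs ↦ ?_) (by simp)
    rw [(hd s).hasDerivWithinAt.derivWithin (uniqueDiffOn_Icc hab s (Ico_subset_Icc_self hs)), hv]
    simp only [projIcc_of_mem hab.le (Ico_subset_Icc_self hs)]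

/-- A small variation of a curve in an open set stays in this set, by compactness of `[a, b]`. -/
theorem eventually_mapsTo_add_smul {E : Type*} [NormedAddCommGroup E] [NormedSpace ℝ E]
    {U : Set E} (hU : IsOpen U) {c η : ℝ → E} (hc : Continuous c) (hη : Continuous η) {a b : ℝ}
    (hcU : MapsTo c (Icc a b) U) :
    ∀ᶠ ε : ℝ in 𝓝 0, MapsTo (fun s ↦ c s + ε • η s) (Icc a b) U := by
  obtain ⟨u, t, hu, -, h0u, ht, hut⟩ := generalized_tube_lemma (s := ({0} : Set ℝ))
    isCompact_singleton (t := Icc a b) isCompact_Icc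
    (n := (fun p : ℝ × ℝ ↦ c p.2 + p.1 • η p.2) ⁻¹' U) (hU.preimage (by fun_prop)) (by
      rintro ⟨e, s⟩ ⟨he, hs⟩
      simp only [mem_singleton_iff] at he
      simpa [he] using hcU hs)
  filter_upwards [hu.mem_nhds (h0u rfl)] with e he s hs
  exact hut (mk_mem_prod he (ht hs))

set_option maxSynthPendingDepth 3 in
/-- The first variation of the energy `∫ G(c)(v, v)` when `c` and `v` vary in the directions `η` and
`w`. In the application, `v` and `w` are the derivatives of `c` and `η`. -/
theorem hasDerivAt_energy {E : Type*} [NormedAddCommGroup E] [NormedSpace ℝ E]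
    {G : E → E →L[ℝ] E →L[ℝ] ℝ} {U : Set E} (hU : IsOpen U) (hG : ContDiffOn ℝ 1 G U)
    {c η v w : ℝ → E} (hc : Continuous c) (hη : Continuous η)
    (hv : Continuous v) (hw : Continuous w) {a b : ℝ} (hab : a ≤ b) (hcU : MapsTo c (Icc a b) U) :
    HasDerivAt (fun ε : ℝ ↦ ∫ s in a..b, G (c s + ε • η s) (v s + ε • w s) (v s + ε • w s))
      (∫ s in a..b, (fderiv ℝ G (c s) (η s) (v s) (v s) + G (c s) (w s) (v s)
        + G (c s) (v s) (w s))) 0 := by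
  obtain ⟨r, hr, hmem⟩ := Metric.nhds_basis_closedBall.mem_iff.1
    (eventually_mapsTo_add_smul hU hc hη hcU)
  set D : ℝ → ℝ → ℝ := fun e s ↦ (fderiv ℝ G (c s + e • η s) (η s) (v s + e • w s)
      + G (c s + e • η s) (w s)) (v s + e • w s) + G (c s + e • η s) (v s + e • w s) (w s) with hD
  have hmaps : MapsTo (fun p : ℝ × ℝ ↦ c p.2 + p.1 • η p.2)
      (Metric.closedBall (0 : ℝ) r ×ˢ Icc a b) U := fun p hp ↦ hmem hp.1 hp.2
  have hGc : ContinuousOn (fun p : ℝ × ℝ ↦ G (c p.2 + p.1 • η p.2))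
      (Metric.closedBall (0 : ℝ) r ×ˢ Icc a b) :=
    hG.continuousOn.comp (Continuous.continuousOn (by fun_prop)) hmaps
  have hG'c : ContinuousOn (fun p : ℝ × ℝ ↦ fderiv ℝ G (c p.2 + p.1 • η p.2))
      (Metric.closedBall (0 : ℝ) r ×ˢ Icc a b) :=
    (hG.continuousOn_fderiv_of_isOpen hU le_rfl).comp
      (Continuous.continuousOn (by fun_prop)) hmaps
  have hFc : ContinuousOn (fun p : ℝ × ℝ ↦ G (c p.2 + p.1 • η p.2) (v p.2 + p.1 • w p.2)
      (v p.2 + p.1 • w p.2)) (Metric.closedBall (0 : ℝ) r ×ˢ Icc a b) :=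
    (hGc.clm_apply (Continuous.continuousOn (by fun_prop))).clm_apply
      (Continuous.continuousOn (by fun_prop))
  have hDc : ContinuousOn (fun p : ℝ × ℝ ↦ D p.1 p.2)
      (Metric.closedBall (0 : ℝ) r ×ˢ Icc a b) := by
    have h1 : ContinuousOn (fun p : ℝ × ℝ ↦ v p.2 + p.1 • w p.2)
      (Metric.closedBall (0 : ℝ) r ×ˢ Icc a b) := Continuous.continuousOn (by fun_prop)
    have h2 : ContinuousOn (fun p : ℝ × ℝ ↦ w p.2)
      (Metric.closedBall (0 : ℝ) r ×ˢ Icc a b) := Continuous.continuousOn (by fun_prop)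
    have h3 : ContinuousOn (fun p : ℝ × ℝ ↦ η p.2)
      (Metric.closedBall (0 : ℝ) r ×ˢ Icc a b) := Continuous.continuousOn (by fun_prop)
    exact (((hG'c.clm_apply h3).clm_apply h1).add (hGc.clm_apply h2)).clm_apply h1 |>.add
      ((hGc.clm_apply h1).clm_apply h2)
  have hslice : ∀ e ∈ Metric.closedBall (0 : ℝ) r, ∀ f : ℝ × ℝ → ℝ,
      ContinuousOn f (Metric.closedBall (0 : ℝ) r ×ˢ Icc a b) →
      ContinuousOn (fun s ↦ f (e, s)) (Icc a b) := fun e he f hf ↦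
    hf.comp (Continuous.continuousOn (by fun_prop)) fun s hs ↦ mk_mem_prod he hs
  obtain ⟨C, hC⟩ :=
    ((isCompact_closedBall (0 : ℝ) r).prod isCompact_Icc).exists_bound_of_continuousOn hDc
  have h0 : (0 : ℝ) ∈ Metric.closedBall (0 : ℝ) r := Metric.mem_closedBall_self hr.le
  have hsub : Ι a b ⊆ Icc a b := by rw [uIoc_of_le hab]; exact Ioc_subset_Icc_self
  have key := (intervalIntegral.hasDerivAt_integral_of_dominated_loc_of_deriv_le (μ := volume)
    (F := fun e s ↦ G (c s + e • η s) (v s + e • w s) (v s + e • w s)) (F' := D) (x₀ := 0)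
    (s := Metric.closedBall (0 : ℝ) r) (a := a) (b := b) (bound := fun _ ↦ C)
    (Metric.closedBall_mem_nhds _ hr) ?_ ?_ ?_ ?_ intervalIntegrable_const ?_).2
  · have e : (∫ s in a..b, (fderiv ℝ G (c s) (η s) (v s) (v s) + G (c s) (w s) (v s)
        + G (c s) (v s) (w s))) = ∫ s in a..b, D 0 s :=
      integral_congr fun s _ ↦ by simp [hD]
    rw [e]
    exact key
  · filter_upwards [Metric.closedBall_mem_nhds (0 : ℝ) hr] with e he
    exact ((hslice e he _ hFc).mono hsub).aestronglyMeasurable measurableSet_uIoc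
  · exact ContinuousOn.intervalIntegrable_of_Icc hab (hslice 0 h0 _ hFc)
  · exact ((hslice 0 h0 _ hDc).mono hsub).aestronglyMeasurable measurableSet_uIoc
  · exact Eventually.of_forall fun s hs e he ↦ hC (e, s) (mk_mem_prod he (hsub hs))
  · refine Eventually.of_forall fun s hs e he ↦ ?_
    have h1 : HasDerivAt (fun e : ℝ ↦ c s + e • η s) (η s) e := by
      simpa using ((hasDerivAt_id e).smul_const (η s)).const_add (c s)
    have h2 : HasDerivAt (fun e : ℝ ↦ v s + e • w s) (w s) e := by
      simpa using ((hasDerivAt_id e).smul_const (w s)).const_add (v s)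
    have hGd : HasFDerivAt G (fderiv ℝ G (c s + e • η s)) (c s + e • η s) :=
      ((hG.contDiffAt (hU.mem_nhds (hmem he (hsub hs)))).differentiableAt
        one_ne_zero).hasFDerivAt
    have h3 : HasDerivAt (fun e : ℝ ↦ G (c s + e • η s))
        (fderiv ℝ G (c s + e • η s) (η s)) e := hGd.comp_hasDerivAt e h1
    have h4 : HasDerivAt (fun e : ℝ ↦ G (c s + e • η s) (v s + e • w s))
        (fderiv ℝ G (c s + e • η s) (η s) (v s + e • w s) + G (c s + e • η s) (w s)) e :=
      h3.clm_apply h2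
    exact h4.clm_apply h2

/-- The du Bois-Reymond lemma for two adjacent intervals: if the first variation with momentum `p`
and force `q` vanishes for all broken variations with fixed endpoints, then `p` is a primitive of
`q` on each interval, with the same constant on both sides of `τ`. -/
theorem eq_const_add_integral_of_forall_variation {E : Type*} [NormedAddCommGroup E]
    [InnerProductSpace ℝ E] [CompleteSpace E] {α τ β : ℝ} (hατ : α < τ) (hτβ : τ < β)
    {p₁ q₁ p₂ q₂ : ℝ → E} (hp₁ : Continuous p₁) (hq₁ : Continuous q₁) (hp₂ : Continuous p₂)
    (hq₂ : Continuous q₂)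
    (h : ∀ η₁ η₂ : ℝ → E, ContDiff ℝ 1 η₁ → ContDiff ℝ 1 η₂ → η₁ α = 0 → η₁ τ = η₂ τ → η₂ β = 0 →
      (∫ s in α..τ, (inner ℝ (q₁ s) (η₁ s) + inner ℝ (p₁ s) (deriv η₁ s)))
        + (∫ s in τ..β, (inner ℝ (q₂ s) (η₂ s) + inner ℝ (p₂ s) (deriv η₂ s))) = 0) :
    ∃ m : E, (∀ s ∈ Icc α τ, p₁ s = m + ∫ r in τ..s, q₁ r) ∧
      ∀ s ∈ Icc τ β, p₂ s = m + ∫ r in τ..s, q₂ r := by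
  set R₁ : ℝ → E := fun s ↦ ∫ r in τ..s, q₁ r with hR₁
  set R₂ : ℝ → E := fun s ↦ ∫ r in τ..s, q₂ r with hR₂
  have dR₁ : ∀ s, HasDerivAt R₁ (q₁ s) s := fun s ↦
    (hq₁.integral_hasStrictDerivAt τ s).hasDerivAt
  have dR₂ : ∀ s, HasDerivAt R₂ (q₂ s) s := fun s ↦
    (hq₂.integral_hasStrictDerivAt τ s).hasDerivAt
  have cR₁ : Continuous R₁ := continuous_iff_continuousAt.2 fun s ↦ (dR₁ s).continuousAt
  have cR₂ : Continuous R₂ := continuous_iff_continuousAt.2 fun s ↦ (dR₂ s).continuousAt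
  have hβα : β - α ≠ 0 := by linarith
  set I₁ : E := ∫ s in α..τ, (p₁ s - R₁ s) with hI₁
  set I₂ : E := ∫ s in τ..β, (p₂ s - R₂ s) with hI₂
  set m : E := (β - α)⁻¹ • (I₁ + I₂) with hm
  have hm' : I₁ + I₂ = (β - α) • m := by rw [hm, smul_smul, mul_inv_cancel₀ hβα, one_smul]
  set w₁ : ℝ → E := fun s ↦ p₁ s - R₁ s - m with hw₁
  set w₂ : ℝ → E := fun s ↦ p₂ s - R₂ s - m with hw₂
  have cw₁ : Continuous w₁ := by fun_prop
  have cw₂ : Continuous w₂ := by fun_prop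
  have iw₁ : ∫ s in α..τ, w₁ s = I₁ - (τ - α) • m := by
    rw [intervalIntegral.integral_sub (f := fun s ↦ p₁ s - R₁ s) (g := fun _ ↦ m)
      ((hp₁.sub cR₁).intervalIntegrable _ _)
      intervalIntegrable_const, intervalIntegral.integral_const]
  have iw₂ : ∫ s in τ..β, w₂ s = I₂ - (β - τ) • m := by
    rw [intervalIntegral.integral_sub (f := fun s ↦ p₂ s - R₂ s) (g := fun _ ↦ m)
      ((hp₂.sub cR₂).intervalIntegrable _ _)
      intervalIntegrable_const, intervalIntegral.integral_const]
  -- The test variation is the primitive of `p - ∫ q - m`; the choice of `m` makes it vanish at `β`.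
  set η₁ : ℝ → E := fun s ↦ ∫ r in α..s, w₁ r with hη₁
  set η₂ : ℝ → E := fun s ↦ η₁ τ + ∫ r in τ..s, w₂ r with hη₂
  have dη₁ : ∀ s, HasDerivAt η₁ (w₁ s) s := fun s ↦
    (cw₁.integral_hasStrictDerivAt α s).hasDerivAt
  have dη₂ : ∀ s, HasDerivAt η₂ (w₂ s) s := fun s ↦
    (cw₂.integral_hasStrictDerivAt τ s).hasDerivAt.const_add _
  have eη₁ : deriv η₁ = w₁ := funext fun s ↦ (dη₁ s).deriv
  have eη₂ : deriv η₂ = w₂ := funext fun s ↦ (dη₂ s).deriv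
  have cη₁ : Continuous η₁ := continuous_iff_continuousAt.2 fun s ↦ (dη₁ s).continuousAt
  have cη₂ : Continuous η₂ := continuous_iff_continuousAt.2 fun s ↦ (dη₂ s).continuousAt
  have η₁α : η₁ α = 0 := by simp [hη₁]
  have η₁τ : η₁ τ = I₁ - (τ - α) • m := iw₁
  have η₂τ : η₁ τ = η₂ τ := by simp [hη₂]
  have η₂β : η₂ β = 0 := by
    have : η₂ β = η₁ τ + ∫ r in τ..β, w₂ r := rfl
    rw [this, η₁τ, iw₂, show I₁ - (τ - α) • m + (I₂ - (β - τ) • m)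
      = (I₁ + I₂) - ((τ - α) + (β - τ)) • m by rw [add_smul]; abel, hm',
      show τ - α + (β - τ) = β - α by ring, sub_self]
  have main := h η₁ η₂ (contDiff_one_iff_deriv.2 ⟨fun s ↦ (dη₁ s).differentiableAt, eη₁ ▸ cw₁⟩)
    (contDiff_one_iff_deriv.2 ⟨fun s ↦ (dη₂ s).differentiableAt, eη₂ ▸ cw₂⟩) η₁α η₂τ η₂β
  rw [eη₁, eη₂] at main
  -- Integrate by parts on each interval: the first variation is then `∫ ‖p - ∫ q - m‖²`.
  have P₁ : ∫ s in α..τ, (inner ℝ (R₁ s + m) (w₁ s) + inner ℝ (q₁ s) (η₁ s)) =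
      inner ℝ (R₁ τ + m) (η₁ τ) - inner ℝ (R₁ α + m) (η₁ α) :=
    integral_eq_sub_of_hasDerivAt (f := fun s ↦ inner ℝ (R₁ s + m) (η₁ s))
      (fun s _ ↦ ((dR₁ s).add_const m).inner ℝ (dη₁ s))
      (Continuous.intervalIntegrable (by fun_prop) _ _)
  have P₂ : ∫ s in τ..β, (inner ℝ (R₂ s + m) (w₂ s) + inner ℝ (q₂ s) (η₂ s)) =
      inner ℝ (R₂ β + m) (η₂ β) - inner ℝ (R₂ τ + m) (η₂ τ) :=
    integral_eq_sub_of_hasDerivAt (f := fun s ↦ inner ℝ (R₂ s + m) (η₂ s))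
      (fun s _ ↦ ((dR₂ s).add_const m).inner ℝ (dη₂ s))
      (Continuous.intervalIntegrable (by fun_prop) _ _)
  have R₁τ : R₁ τ = 0 := by simp [hR₁]
  have R₂τ : R₂ τ = 0 := by simp [hR₂]
  rw [η₁α, R₁τ] at P₁
  rw [η₂β, R₂τ, ← η₂τ] at P₂
  have S₁ : (∫ s in α..τ, (inner ℝ (q₁ s) (η₁ s) + inner ℝ (p₁ s) (w₁ s))) =
      (∫ s in α..τ, ‖w₁ s‖ ^ 2) +
        ∫ s in α..τ, (inner ℝ (R₁ s + m) (w₁ s) + inner ℝ (q₁ s) (η₁ s)) := by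
    rw [← intervalIntegral.integral_add (Continuous.intervalIntegrable (by fun_prop) _ _)
      (Continuous.intervalIntegrable (by fun_prop) _ _)]
    refine integral_congr fun s _ ↦ ?_
    have : p₁ s = w₁ s + (R₁ s + m) := by simp only [hw₁]; abel
    rw [this, inner_add_left, real_inner_self_eq_norm_sq]
    ring
  have S₂ : (∫ s in τ..β, (inner ℝ (q₂ s) (η₂ s) + inner ℝ (p₂ s) (w₂ s))) =
      (∫ s in τ..β, ‖w₂ s‖ ^ 2) +
        ∫ s in τ..β, (inner ℝ (R₂ s + m) (w₂ s) + inner ℝ (q₂ s) (η₂ s)) := by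
    rw [← intervalIntegral.integral_add (Continuous.intervalIntegrable (by fun_prop) _ _)
      (Continuous.intervalIntegrable (by fun_prop) _ _)]
    refine integral_congr fun s _ ↦ ?_
    have : p₂ s = w₂ s + (R₂ s + m) := by simp only [hw₂]; abel
    rw [this, inner_add_left, real_inner_self_eq_norm_sq]
    ring
  rw [S₁, S₂, P₁, P₂] at main
  simp only [inner_zero_right, zero_add] at main
  have N₁ : 0 ≤ ∫ s in α..τ, ‖w₁ s‖ ^ 2 :=
    integral_nonneg hατ.le fun s _ ↦ by positivity
  have N₂ : 0 ≤ ∫ s in τ..β, ‖w₂ s‖ ^ 2 :=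
    integral_nonneg hτβ.le fun s _ ↦ by positivity
  have vanish : ∀ {x y : ℝ} {w : ℝ → E}, x < y → Continuous w → ∫ s in x..y, ‖w s‖ ^ 2 ≤ 0 →
      ∀ s ∈ Icc x y, w s = 0 := by
    intro x y w hxy hw hi s hs
    by_contra hne
    exact absurd hi (not_le.2 (integral_pos hxy (by fun_prop) (fun _ _ ↦ by positivity)
      ⟨s, hs, by positivity⟩))
  refine ⟨m, fun s hs ↦ ?_, fun s hs ↦ ?_⟩
  · have := vanish hατ cw₁ (by linarith) s hs
    simp only [hw₁] at this
    rw [sub_sub, sub_eq_zero] at this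
    rw [this, add_comm]
  · have := vanish hτβ cw₂ (by linarith) s hs
    simp only [hw₂] at this
    rw [sub_sub, sub_eq_zero] at this
    rw [this, add_comm]

end Analysis

/-! ### The Euler–Lagrange equation for the energy -/

section EulerLagrange

open MeasureTheory intervalIntegral Filter
open scoped Interval

variable {E : Type*} [NormedAddCommGroup E] [InnerProductSpace ℝ E] [FiniteDimensional ℝ E]

theorem isInvertible_of_forall_pos (B : E →L[ℝ] E →L[ℝ] ℝ) (hB : ∀ v, v ≠ 0 → 0 < B v v) :
    B.IsInvertible := by
  have hinj : Function.Injective (B : E →ₗ[ℝ] E →L[ℝ] ℝ) := by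
    refine (injective_iff_map_eq_zero _).2 fun v hv ↦ ?_
    by_contra hne
    have h0 : B v = 0 := hv
    simpa [h0] using hB v hne
  have hfin : Module.finrank ℝ E = Module.finrank ℝ (E →L[ℝ] ℝ) := by
    rw [← (LinearMap.toContinuousLinearMap (𝕜 := ℝ) (E := E) (F' := ℝ)).finrank_eq]
    exact Subspace.dual_finrank_eq.symm
  refine ⟨((B : E →ₗ[ℝ] E →L[ℝ] ℝ).linearEquivOfInjective hinj hfin).toContinuousLinearEquiv, ?_⟩
  ext v w
  rfl

set_option maxSynthPendingDepth 3 in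
/-- The differential of `u ↦ G u v v`, as a linear form. -/
noncomputable def fderivQuadratic (G : E → E →L[ℝ] E →L[ℝ] ℝ) (u v : E) : E →L[ℝ] ℝ :=
  ((fderiv ℝ G u).flip v).flip v

set_option maxSynthPendingDepth 3 in
omit [FiniteDimensional ℝ E] in
theorem fderivQuadratic_apply (G : E → E →L[ℝ] E →L[ℝ] ℝ) (u v z : E) :
    fderivQuadratic G u v z = fderiv ℝ G u z v v := rfl

set_option maxSynthPendingDepth 3 in
theorem continuousOn_fderivQuadratic {G : E → E →L[ℝ] E →L[ℝ] ℝ} {U : Set E} (hU : IsOpen U)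
    (hG : ContDiffOn ℝ 1 G U) {c v : ℝ → E} {s : Set ℝ} (hc : ContinuousOn c s)
    (hv : ContinuousOn v s) (hcU : MapsTo c s U) :
    ContinuousOn (fun r ↦ fderivQuadratic G (c r) (v r)) s := by
  refine continuousOn_clm_apply.2 fun z ↦ ?_
  have h1 : ContinuousOn (fun r ↦ fderiv ℝ G (c r)) s :=
    (hG.continuousOn_fderiv_of_isOpen hU le_rfl).comp hc hcU
  exact ((h1.clm_apply continuousOn_const).clm_apply hv).clm_apply hv

set_option maxSynthPendingDepth 3 in
/-- The integrated Euler–Lagrange equation for a broken curve which minimizes the energy among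
broken curves with the same endpoints. The forces `q₁`, `q₂` represent half the differential of the
energy density in the position, and the momentum `G(c)(c', ·)` has the same value `m` on both
sides of the
corner. -/
theorem momentum_eq_of_energy_min {G : E → E →L[ℝ] E →L[ℝ] ℝ} {U : Set E} (hU : IsOpen U)
    (hG : ContDiffOn ℝ 1 G U) (hsymm : ∀ u ∈ U, ∀ v w, G u v w = G u w v)
    {α τ β : ℝ} (hατ : α < τ) (hτβ : τ < β) {c₁ c₂ : ℝ → E}
    (hc₁ : ContDiff ℝ 1 c₁) (hc₂ : ContDiff ℝ 1 c₂) (hU₁ : MapsTo c₁ (Icc α τ) U)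
    (hU₂ : MapsTo c₂ (Icc τ β) U)
    (hmin : ∀ η₁ η₂ : ℝ → E, ContDiff ℝ 1 η₁ → ContDiff ℝ 1 η₂ →
      η₁ α = 0 → η₁ τ = η₂ τ → η₂ β = 0 → ∀ᶠ ε : ℝ in 𝓝 0,
      (∫ s in α..τ, G (c₁ s) (deriv c₁ s) (deriv c₁ s))
        + (∫ s in τ..β, G (c₂ s) (deriv c₂ s) (deriv c₂ s)) ≤
      (∫ s in α..τ, G (c₁ s + ε • η₁ s) (deriv c₁ s + ε • deriv η₁ s)
          (deriv c₁ s + ε • deriv η₁ s))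
        + (∫ s in τ..β, G (c₂ s + ε • η₂ s) (deriv c₂ s + ε • deriv η₂ s)
          (deriv c₂ s + ε • deriv η₂ s))) :
    ∃ (m : E) (q₁ q₂ : ℝ → E), Continuous q₁ ∧ Continuous q₂ ∧
      (∀ s ∈ Icc α τ, ∀ z, inner ℝ (q₁ s) z = 2⁻¹ * fderivQuadratic G (c₁ s) (deriv c₁ s) z) ∧
      (∀ s ∈ Icc τ β, ∀ z, inner ℝ (q₂ s) z = 2⁻¹ * fderivQuadratic G (c₂ s) (deriv c₂ s) z) ∧
      (∀ s ∈ Icc α τ, ∀ z, G (c₁ s) (deriv c₁ s) z = inner ℝ (m + ∫ r in τ..s, q₁ r) z) ∧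
      (∀ s ∈ Icc τ β, ∀ z, G (c₂ s) (deriv c₂ s) z = inner ℝ (m + ∫ r in τ..s, q₂ r) z) := by
  have extend : ∀ {x y : ℝ} (hxy : x ≤ y) (f : ℝ → E →L[ℝ] ℝ), ContinuousOn f (Icc x y) →
      ∃ F : ℝ → E, Continuous F ∧ ∀ s ∈ Icc x y, ∀ z, inner ℝ (F s) z = f s z := by
    intro x y hxy f hf
    refine ⟨fun s ↦ (InnerProductSpace.toDual ℝ E).symm (f (projIcc x y hxy s)),
      (InnerProductSpace.toDual ℝ E).symm.continuous.comp
        (hf.comp_continuous (continuous_subtype_val.comp continuous_projIcc)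
          fun s ↦ (projIcc x y hxy s).2), fun s hs z ↦ ?_⟩
    rw [InnerProductSpace.toDual_symm_apply, projIcc_of_mem hxy hs]
  have d₁ : Continuous (deriv c₁) := hc₁.continuous_deriv le_rfl
  have d₂ : Continuous (deriv c₂) := hc₂.continuous_deriv le_rfl
  obtain ⟨p₁, cp₁, hp₁⟩ := extend hατ.le (fun s ↦ G (c₁ s) (deriv c₁ s))
    ((hG.continuousOn.comp hc₁.continuous.continuousOn hU₁).clm_apply d₁.continuousOn)
  obtain ⟨p₂, cp₂, hp₂⟩ := extend hτβ.le (fun s ↦ G (c₂ s) (deriv c₂ s))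
    ((hG.continuousOn.comp hc₂.continuous.continuousOn hU₂).clm_apply d₂.continuousOn)
  obtain ⟨q₁, cq₁, hq₁⟩ := extend hατ.le
    (fun s ↦ (2⁻¹ : ℝ) • fderivQuadratic G (c₁ s) (deriv c₁ s))
    ((continuousOn_fderivQuadratic hU hG hc₁.continuous.continuousOn
      d₁.continuousOn hU₁).const_smul (2⁻¹ : ℝ))
  obtain ⟨q₂, cq₂, hq₂⟩ := extend hτβ.le
    (fun s ↦ (2⁻¹ : ℝ) • fderivQuadratic G (c₂ s) (deriv c₂ s))
    ((continuousOn_fderivQuadratic hU hG hc₂.continuous.continuousOn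
      d₂.continuousOn hU₂).const_smul (2⁻¹ : ℝ))
  have variation : ∀ {x y : ℝ}, x ≤ y → ∀ {c η p q : ℝ → E}, MapsTo c (Icc x y) U →
      (∀ s ∈ Icc x y, ∀ z, inner ℝ (p s) z = G (c s) (deriv c s) z) →
      (∀ s ∈ Icc x y, ∀ z, inner ℝ (q s) z =
        ((2⁻¹ : ℝ) • fderivQuadratic G (c s) (deriv c s)) z) →
      ∫ s in x..y, (fderiv ℝ G (c s) (η s) (deriv c s) (deriv c s)
        + G (c s) (deriv η s) (deriv c s) + G (c s) (deriv c s) (deriv η s)) =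
      2 * ∫ s in x..y, (inner ℝ (q s) (η s) + inner ℝ (p s) (deriv η s)) := by
    intro x y hxy c η p q hcU hp hq
    rw [← intervalIntegral.integral_const_mul]
    refine integral_congr fun s hs ↦ ?_
    rw [uIcc_of_le hxy] at hs
    rw [hp s hs, hq s hs, hsymm _ (hcU hs) (deriv η s), smul_apply,
      fderivQuadratic_apply, smul_eq_mul]
    ring
  obtain ⟨m, hm₁, hm₂⟩ := eq_const_add_integral_of_forall_variation hατ hτβ cp₁ cq₁ cp₂ cq₂ (by
    intro η₁ η₂ hη₁ hη₂ h1 h2 h3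
    have D := (hasDerivAt_energy hU hG hc₁.continuous hη₁.continuous d₁
      (hη₁.continuous_deriv le_rfl) hατ.le hU₁).add
      (hasDerivAt_energy hU hG hc₂.continuous hη₂.continuous d₂
      (hη₂.continuous_deriv le_rfl) hτβ.le hU₂)
    have h0 := (fun hloc ↦ IsLocalMin.hasDerivAt_eq_zero hloc D) (by
      refine (hmin η₁ η₂ hη₁ hη₂ h1 h2 h3).mono fun ε hε ↦ ?_
      simpa using hε)
    rw [variation hατ.le hU₁ hp₁ hq₁, variation hτβ.le hU₂ hp₂ hq₂] at h0
    linarith)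
  refine ⟨m, q₁, q₂, cq₁, cq₂, fun s hs z ↦ hq₁ s hs z, fun s hs z ↦ hq₂ s hs z,
    fun s hs z ↦ ?_, fun s hs z ↦ ?_⟩
  · rw [← hm₁ s hs, hp₁ s hs]
  · rw [← hm₂ s hs, hp₂ s hs]

set_option maxSynthPendingDepth 3 in
/-- A possibly broken minimizer of the energy is `C²`, and satisfies the Euler–Lagrange equation. -/
theorem contDiffOn_two_of_energy_min {G : E → E →L[ℝ] E →L[ℝ] ℝ} {U : Set E} (hU : IsOpen U)
    (hG : ContDiffOn ℝ 1 G U) (hsymm : ∀ u ∈ U, ∀ v w, G u v w = G u w v)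
    (hpos : ∀ u ∈ U, ∀ v, v ≠ 0 → 0 < G u v v)
    {α τ β : ℝ} (hατ : α < τ) (hτβ : τ < β) {c c₁ c₂ : ℝ → E}
    (hc₁ : ContDiff ℝ 1 c₁) (hc₂ : ContDiff ℝ 1 c₂) (e₁ : EqOn c c₁ (Icc α τ))
    (e₂ : EqOn c c₂ (Icc τ β)) (hcU : MapsTo c (Icc α β) U)
    (hmin : ∀ η₁ η₂ : ℝ → E, ContDiff ℝ 1 η₁ → ContDiff ℝ 1 η₂ →
      η₁ α = 0 → η₁ τ = η₂ τ → η₂ β = 0 → ∀ᶠ ε : ℝ in 𝓝 0,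
      (∫ s in α..τ, G (c₁ s) (deriv c₁ s) (deriv c₁ s))
        + (∫ s in τ..β, G (c₂ s) (deriv c₂ s) (deriv c₂ s)) ≤
      (∫ s in α..τ, G (c₁ s + ε • η₁ s) (deriv c₁ s + ε • deriv η₁ s)
          (deriv c₁ s + ε • deriv η₁ s))
        + (∫ s in τ..β, G (c₂ s + ε • η₂ s) (deriv c₂ s + ε • deriv η₂ s)
          (deriv c₂ s + ε • deriv η₂ s))) :
    ContDiffOn ℝ 2 c (Icc α β) ∧ ∀ s ∈ Icc α β, ∀ z,
      G (c s) (derivWithin (derivWithin c (Icc α β)) (Icc α β) s) z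
        + (fderiv ℝ G (c s) (derivWithin c (Icc α β) s) (derivWithin c (Icc α β) s) z
          - 2⁻¹ * fderivQuadratic G (c s) (derivWithin c (Icc α β) s) z) = 0 := by
  have hU₁ : MapsTo c₁ (Icc α τ) U := fun s hs ↦ e₁ hs ▸ hcU ⟨hs.1, hs.2.trans hτβ.le⟩
  have hU₂ : MapsTo c₂ (Icc τ β) U := fun s hs ↦ e₂ hs ▸ hcU ⟨hατ.le.trans hs.1, hs.2⟩
  obtain ⟨m, q₁, q₂, cq₁, cq₂, hq₁, hq₂, hp₁, hp₂⟩ :=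
    momentum_eq_of_energy_min hU hG hsymm hατ hτβ hc₁ hc₂ hU₁ hU₂ hmin
  have d₁ : Continuous (deriv c₁) := hc₁.continuous_deriv le_rfl
  have d₂ : Continuous (deriv c₂) := hc₂.continuous_deriv le_rfl
  have τ₁ : τ ∈ Icc α τ := right_mem_Icc.2 hατ.le
  have τ₂ : τ ∈ Icc τ β := left_mem_Icc.2 hτβ.le
  have τc : c₁ τ = c₂ τ := (e₁ τ₁).symm.trans (e₂ τ₂)
  -- The momentum is continuous at `τ`, hence so is the velocity, as the metric is nondegenerate.
  have τd : deriv c₁ τ = deriv c₂ τ := by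
    by_contra hne
    have h1 := hp₁ τ τ₁ (deriv c₁ τ - deriv c₂ τ)
    have h2 := hp₂ τ τ₂ (deriv c₁ τ - deriv c₂ τ)
    have h3 := hpos _ (hU₂ τ₂) _ (sub_ne_zero.2 hne)
    rw [integral_same, add_zero] at h1 h2
    rw [(G (c₂ τ)).map_sub, sub_apply, h2, ← τc, h1, sub_self] at h3
    exact h3.false
  have τq : q₁ τ = q₂ τ := by
    refine ext_inner_right ℝ fun z ↦ ?_
    rw [hq₁ τ τ₁, hq₂ τ τ₂, τc, τd]
  set v : ℝ → E := fun s ↦ if s ≤ τ then deriv c₁ s else deriv c₂ s with hv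
  set q : ℝ → E := fun s ↦ if s ≤ τ then q₁ s else q₂ s with hq
  have cv : Continuous v := Continuous.if_le d₁ d₂ continuous_id continuous_const
    fun s hs ↦ by rw [show s = τ from hs, τd]
  have cq : Continuous q := Continuous.if_le cq₁ cq₂ continuous_id continuous_const
    fun s hs ↦ by rw [show s = τ from hs, τq]
  have v₁ : ∀ s ∈ Icc α τ, v s = deriv c₁ s := fun s hs ↦ if_pos hs.2
  have v₂ : ∀ s ∈ Icc τ β, v s = deriv c₂ s := fun s hs ↦ by
    rcases hs.1.eq_or_lt with rfl | h
    · rw [← τd]; exact if_pos le_rfl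
    · exact if_neg (not_le.2 h)
  have q₁' : ∀ s ∈ Icc α τ, q s = q₁ s := fun s hs ↦ if_pos hs.2
  have q₂' : ∀ s ∈ Icc τ β, q s = q₂ s := fun s hs ↦ by
    rcases hs.1.eq_or_lt with rfl | h
    · rw [← τq]; exact if_pos le_rfl
    · exact if_neg (not_le.2 h)
  have hunion : Icc α τ ∪ Icc τ β = Icc α β := Icc_union_Icc_eq_Icc hατ.le hτβ.le
  have hαβ : α < β := hατ.trans hτβ
  have hu : UniqueDiffOn ℝ (Icc α β) := uniqueDiffOn_Icc hαβ
  have dc : ∀ s ∈ Icc α β, HasDerivWithinAt c (v s) (Icc α β) s := by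
    intro s hs
    rw [← hunion]
    refine HasDerivWithinAt.union ?_ ?_
    · by_cases h : s ∈ Icc α τ
      · rw [v₁ s h]
        exact ((hc₁.differentiable one_ne_zero s).hasDerivAt.hasDerivWithinAt).congr e₁ (e₁ h)
      · exact HasFDerivWithinAt.of_notMem_closure (by rwa [isClosed_Icc.closure_eq])
    · by_cases h : s ∈ Icc τ β
      · rw [v₂ s h]
        exact ((hc₂.differentiable one_ne_zero s).hasDerivAt.hasDerivWithinAt).congr e₂ (e₂ h)
      · exact HasFDerivWithinAt.of_notMem_closure (by rwa [isClosed_Icc.closure_eq])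
  have dcv : EqOn (derivWithin c (Icc α β)) v (Icc α β) := fun s hs ↦
    (dc s hs).derivWithin (hu s hs)
  set K : ℝ → E := fun s ↦ m + ∫ r in τ..s, q r with hK
  have dK : ∀ s, HasDerivAt K (q s) s := fun s ↦
    (cq.integral_hasStrictDerivAt τ s).hasDerivAt.const_add _
  have hKq : ContDiff ℝ 1 K := contDiff_one_iff_deriv.2
    ⟨fun s ↦ (dK s).differentiableAt, by rwa [show deriv K = q from funext fun s ↦ (dK s).deriv]⟩
  have momentum : ∀ s ∈ Icc α β, ∀ z, G (c s) (v s) z = inner ℝ (K s) z := by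
    intro s hs z
    rcases le_total s τ with h | h
    · have hs' : s ∈ Icc α τ := ⟨hs.1, h⟩
      rw [e₁ hs', v₁ s hs', hp₁ s hs', hK]
      simp only
      rw [integral_congr fun r hr ↦ q₁' r ?_]
      rw [uIcc_of_ge h] at hr
      exact ⟨hs.1.trans hr.1, hr.2⟩
    · have hs' : s ∈ Icc τ β := ⟨h, hs.2⟩
      rw [e₂ hs', v₂ s hs', hp₂ s hs', hK]
      simp only
      rw [integral_congr fun r hr ↦ q₂' r ?_]
      rw [uIcc_of_le h] at hr
      exact ⟨hr.1, hr.2.trans hs.2⟩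
  have force : ∀ s ∈ Icc α β, ∀ z, inner ℝ (q s) z = 2⁻¹ * fderivQuadratic G (c s) (v s) z := by
    intro s hs z
    rcases le_total s τ with h | h
    · have hs' : s ∈ Icc α τ := ⟨hs.1, h⟩
      rw [e₁ hs', v₁ s hs', q₁' s hs', hq₁ s hs']
    · have hs' : s ∈ Icc τ β := ⟨h, hs.2⟩
      rw [e₂ hs', v₂ s hs', q₂' s hs', hq₂ s hs']
  have hcdiff : DifferentiableOn ℝ c (Icc α β) := fun s hs ↦ (dc s hs).differentiableWithinAt
  have hc1 : ContDiffOn ℝ 1 c (Icc α β) := by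
    rw [← zero_add (1 : WithTop ℕ∞), contDiffOn_succ_iff_derivWithin hu]
    exact ⟨hcdiff, by simp, contDiffOn_zero.2 (cv.continuousOn.congr dcv)⟩
  -- The velocity is the image of the `C¹` momentum under the inverse of the metric, so it is `C¹`.
  set Λ : ℝ → E →L[ℝ] ℝ := fun s ↦ InnerProductSpace.toDual ℝ E (K s) with hΛ
  have hΛc : ContDiffOn ℝ 1 Λ (Icc α β) := by
    refine contDiffOn_clm_apply.2 fun z ↦ ?_
    simp only [hΛ, InnerProductSpace.toDual_apply_apply]
    exact (hKq.inner ℝ contDiff_const).contDiffOn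
  have hvΛ : EqOn v (fun s ↦ (G (c s)).inverse (Λ s)) (Icc α β) := by
    intro s hs
    have hinv := isInvertible_of_forall_pos (G (c s)) (hpos _ (hcU hs))
    have : G (c s) (v s) = Λ s := by
      ext z
      rw [momentum s hs, hΛ, InnerProductSpace.toDual_apply_apply]
    simp only
    rw [← this, ← ContinuousLinearMap.comp_apply, hinv.inverse_comp_self]
    rfl
  have hvc : ContDiffOn ℝ 1 v (Icc α β) := by
    refine ContDiffOn.congr ?_ hvΛ
    refine ContDiffOn.clm_apply (fun s hs ↦ ?_) hΛc
    exact (isInvertible_of_forall_pos (G (c s))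
      (hpos _ (hcU hs))).contDiffAt_map_inverse.comp_contDiffWithinAt s
        ((hG.contDiffAt (hU.mem_nhds (hcU hs))).comp_contDiffWithinAt s (hc1 s hs))
  refine ⟨?_, fun s hs z ↦ ?_⟩
  · rw [← one_add_one_eq_two, contDiffOn_succ_iff_derivWithin hu]
    exact ⟨hcdiff, by simp, hvc.congr dcv⟩
  · rw [derivWithin_congr dcv (dcv hs), dcv hs]
    have dv : HasDerivWithinAt v (derivWithin v (Icc α β) s) (Icc α β) s :=
      (hvc.differentiableOn one_ne_zero s hs).hasDerivWithinAt
    have dG : HasDerivWithinAt (fun r ↦ G (c r)) (fderiv ℝ G (c s) (v s)) (Icc α β) s :=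
      ((hG.contDiffAt (hU.mem_nhds (hcU hs))).differentiableAt
        one_ne_zero).hasFDerivAt.comp_hasDerivWithinAt s (dc s hs)
    have h1 : HasDerivWithinAt (fun r ↦ G (c r) (v r)) (fderiv ℝ G (c s) (v s) (v s)
        + G (c s) (derivWithin v (Icc α β) s)) (Icc α β) s := dG.clm_apply dv
    have h2 : HasDerivWithinAt (fun r ↦ G (c r) (v r) z) (fderiv ℝ G (c s) (v s) (v s) z
        + G (c s) (derivWithin v (Icc α β) s) z) (Icc α β) s := by
      simpa using h1.clm_apply (hasDerivWithinAt_const s (Icc α β) z)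
    have h3 : HasDerivWithinAt (fun r ↦ G (c r) (v r) z) (inner ℝ (q s) z) (Icc α β) s := by
      have := ((dK s).inner ℝ (hasDerivAt_const s z)).hasDerivWithinAt (s := Icc α β)
      rw [inner_zero_right, zero_add] at this
      exact this.congr (fun r hr ↦ momentum r hr z) (momentum s hs z)
    have := (hu s hs).eq_deriv _ h2 h3
    rw [force s hs] at this
    linarith

end EulerLagrange

/-! ### The Riemannian metric in a chart -/

section ChartMetric

variable {n : ℕ} {S : Type*} [TopologicalSpace S] [ChartedSpace (EuclideanSpace ℝ (Fin n)) S]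
  [RiemannianBundle (fun x : S ↦ TangentSpace (𝓡 n) x)]

/-- The metric in the chart at `p`, as a continuous bilinear form depending on the point. -/
noncomputable def chartMetric (p : S) (u : EuclideanSpace ℝ (Fin n)) :
    EuclideanSpace ℝ (Fin n) →L[ℝ] EuclideanSpace ℝ (Fin n) →L[ℝ] ℝ :=
  (LinearMap.mk₂ ℝ (metricInChart p u)
    (fun v v' w ↦ by
      unfold metricInChart
      erw [map_add, inner_add_left])
    (fun a v w ↦ by
      unfold metricInChart
      erw [map_smul, inner_smul_left]
      rfl)
    (fun v w w' ↦ by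
      unfold metricInChart
      erw [map_add, inner_add_right])
    (fun a v w ↦ by
      unfold metricInChart
      erw [map_smul, inner_smul_right]
      rfl)).toContinuousBilinearMap

theorem chartMetric_apply (p : S) (u v w : EuclideanSpace ℝ (Fin n)) :
    chartMetric p u v w = metricInChart p u v w := rfl

theorem metricInChart_comm (p : S) (u v w : EuclideanSpace ℝ (Fin n)) :
    metricInChart p u v w = metricInChart p u w v :=
  real_inner_comm _ _

theorem metricInChart_self_nonneg (p : S) (u v : EuclideanSpace ℝ (Fin n)) :
    0 ≤ metricInChart p u v v :=
  real_inner_self_nonneg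

variable [IsManifold (𝓡 n) ∞ S]

theorem metricInChart_pos (p : S) {u : EuclideanSpace ℝ (Fin n)}
    (hu : u ∈ (extChartAt (𝓡 n) p).target) {v : EuclideanSpace ℝ (Fin n)} (hv : v ≠ 0) :
    0 < metricInChart p u v v := by
  refine real_inner_self_pos.2 fun h0 ↦ hv ?_
  have h := mfderiv_extChartAt_comp_mfderivWithin_extChartAt_symm (I := 𝓡 n) hu
  rw [ModelWithCorners.range_eq_univ, mfderivWithin_univ] at h
  have h1 : mfderiv (𝓡 n) 𝓘(ℝ, EuclideanSpace ℝ (Fin n)) (extChartAt (𝓡 n) p)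
      ((extChartAt (𝓡 n) p).symm u)
      (mfderiv 𝓘(ℝ, EuclideanSpace ℝ (Fin n)) (𝓡 n) (extChartAt (𝓡 n) p).symm u v) = v :=
    DFunLike.congr_fun h v
  exact h1.symm.trans ((congrArg _ h0).trans (map_zero _))

/-- The inverse of the chart at `p` is an isometry from the chart metric to the metric. -/
theorem metricInChart_mfderiv (p : S) {x : S} (hx : x ∈ (extChartAt (𝓡 n) p).source)
    (v w : TangentSpace (𝓡 n) x) :
    metricInChart p (extChartAt (𝓡 n) p x)
      (mfderiv (𝓡 n) 𝓘(ℝ, EuclideanSpace ℝ (Fin n)) (extChartAt (𝓡 n) p) x v)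
      (mfderiv (𝓡 n) 𝓘(ℝ, EuclideanSpace ℝ (Fin n)) (extChartAt (𝓡 n) p) x w) = inner ℝ v w := by
  obtain ⟨u, hu, rfl⟩ : ∃ u ∈ (extChartAt (𝓡 n) p).target, (extChartAt (𝓡 n) p).symm u = x :=
    ⟨_, (extChartAt (𝓡 n) p).map_source hx, (extChartAt (𝓡 n) p).left_inv hx⟩
  rw [(extChartAt (𝓡 n) p).right_inv hu]
  have h := mfderivWithin_extChartAt_symm_comp_mfderiv_extChartAt (I := 𝓡 n) hu
  rw [ModelWithCorners.range_eq_univ, mfderivWithin_univ] at h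
  have h1 : ∀ v, mfderiv 𝓘(ℝ, EuclideanSpace ℝ (Fin n)) (𝓡 n) (extChartAt (𝓡 n) p).symm u
      (mfderiv (𝓡 n) 𝓘(ℝ, EuclideanSpace ℝ (Fin n)) (extChartAt (𝓡 n) p)
        ((extChartAt (𝓡 n) p).symm u) v) = v := fun v ↦ DFunLike.congr_fun h v
  exact congrArg₂ (inner ℝ) (h1 v) (h1 w)

/-- The square of the speed of a curve is computed in the chart at `p` by the chart metric. -/
theorem norm_mfderivWithin_sq_eq_metricInChart (p : S) {σ : ℝ → S} {s : Set ℝ} {t : ℝ}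
    (hσ : MDifferentiableWithinAt 𝓘(ℝ, ℝ) (𝓡 n) σ s t) (ht : UniqueDiffWithinAt ℝ s t)
    (hp : σ t ∈ (extChartAt (𝓡 n) p).source) :
    ‖(mfderivWithin 𝓘(ℝ, ℝ) (𝓡 n) σ s t (1 : ℝ) : TangentSpace (𝓡 n) (σ t))‖ ^ 2 =
      metricInChart p (extChartAt (𝓡 n) p (σ t))
        (derivWithin (fun r ↦ extChartAt (𝓡 n) p (σ r)) s t)
        (derivWithin (fun r ↦ extChartAt (𝓡 n) p (σ r)) s t) := by
  have hφ : MDifferentiableAt (𝓡 n) 𝓘(ℝ, EuclideanSpace ℝ (Fin n)) (extChartAt (𝓡 n) p) (σ t) :=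
    mdifferentiableAt_extChartAt (by rwa [extChartAt_source] at hp)
  have h1 : derivWithin (fun r ↦ extChartAt (𝓡 n) p (σ r)) s t =
      mfderiv (𝓡 n) 𝓘(ℝ, EuclideanSpace ℝ (Fin n)) (extChartAt (𝓡 n) p) (σ t)
        (mfderivWithin 𝓘(ℝ, ℝ) (𝓡 n) σ s t (1 : ℝ)) := by
    have := mfderiv_comp_mfderivWithin t hφ hσ ht.uniqueMDiffWithinAt
    rw [mfderivWithin_eq_fderivWithin] at this
    exact DFunLike.congr_fun this (1 : ℝ)
  rw [h1, metricInChart_mfderiv p hp, real_inner_self_eq_norm_sq]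

variable [IsContMDiffRiemannianBundle (𝓡 n) ∞ (EuclideanSpace ℝ (Fin n))
      (fun x : S ↦ TangentSpace (𝓡 n) x)]

theorem contDiffOn_metricInChart (p : S) (v w : EuclideanSpace ℝ (Fin n)) :
    ContDiffOn ℝ ∞ (fun u ↦ metricInChart p u v w) (extChartAt (𝓡 n) p).target := by
  have hopen : IsOpen (extChartAt (𝓡 n) p).target := isOpen_extChartAt_target p
  have key : ∀ v : EuclideanSpace ℝ (Fin n),
      ContMDiffOn 𝓘(ℝ, EuclideanSpace ℝ (Fin n)) (𝓡 n).tangent ∞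
      (fun u ↦ (⟨(extChartAt (𝓡 n) p).symm u,
        mfderiv 𝓘(ℝ, EuclideanSpace ℝ (Fin n)) (𝓡 n) (extChartAt (𝓡 n) p).symm u v⟩ :
          TangentBundle (𝓡 n) S)) (extChartAt (𝓡 n) p).target := by
    intro v
    have h1 := (contMDiffOn_extChartAt_symm (I := 𝓡 n) (n := ∞) p).contMDiffOn_tangentMapWithin
      (m := ∞) le_rfl hopen.uniqueMDiffOn
    have h2 : ContMDiff 𝓘(ℝ, EuclideanSpace ℝ (Fin n)) 𝓘(ℝ, EuclideanSpace ℝ (Fin n)).tangent ∞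
        (fun u : EuclideanSpace ℝ (Fin n) ↦
          (⟨u, v⟩ : TangentBundle 𝓘(ℝ, EuclideanSpace ℝ (Fin n)) (EuclideanSpace ℝ (Fin n)))) :=
      contMDiff_vectorSpace_iff_contDiff.2 contDiff_const
    refine (h1.comp (h2.contMDiffOn (s := (extChartAt (𝓡 n) p).target)) fun u hu ↦ hu).congr
      fun u hu ↦ ?_
    simp only [Function.comp_apply, tangentMapWithin]
    rw [mfderivWithin_of_isOpen hopen hu]
  exact contMDiffOn_iff_contDiffOn.1 ((key v).inner_bundle (key w))

theorem contDiffOn_chartMetric (p : S) :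
    ContDiffOn ℝ ∞ (chartMetric p) (extChartAt (𝓡 n) p).target :=
  contDiffOn_clm_apply.2 fun v ↦ contDiffOn_clm_apply.2 fun w ↦ contDiffOn_metricInChart p v w

set_option maxSynthPendingDepth 3 in
theorem fderiv_metricInChart (p : S) {u : EuclideanSpace ℝ (Fin n)}
    (hu : u ∈ (extChartAt (𝓡 n) p).target) (v w z : EuclideanSpace ℝ (Fin n)) :
    fderiv ℝ (fun u' ↦ metricInChart p u' w z) u v = fderiv ℝ (chartMetric p) u v w z := by
  have h : HasFDerivAt (chartMetric p) (fderiv ℝ (chartMetric p) u) u :=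
    (((contDiffOn_chartMetric p).contDiffAt
      ((isOpen_extChartAt_target p).mem_nhds hu)).differentiableAt (by simp)).hasFDerivAt
  have h1 := (h.clm_apply (hasFDerivAt_const w u)).clm_apply (hasFDerivAt_const z u)
  have h2 : fderiv ℝ (fun u' ↦ metricInChart p u' w z) u = _ := h1.fderiv
  rw [h2]
  simp

set_option maxSynthPendingDepth 3 in
/-- The form in which the Christoffel symbols appear in the Euler–Lagrange equation. -/
theorem christoffelInChart_self (p : S) {u : EuclideanSpace ℝ (Fin n)}
    (hu : u ∈ (extChartAt (𝓡 n) p).target) (v z : EuclideanSpace ℝ (Fin n)) :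
    christoffelInChart p u v v z =
      fderiv ℝ (chartMetric p) u v v z - 2⁻¹ * fderivQuadratic (chartMetric p) u v z := by
  rw [christoffelInChart, fderiv_metricInChart p hu, fderiv_metricInChart p hu,
    fderivQuadratic_apply]
  ring

end ChartMetric

/-! ### Minimizing curves in a chart -/

section Subunit

open MeasureTheory Manifold Filter

variable {n : ℕ} {S : Type*} [TopologicalSpace S] [ChartedSpace (EuclideanSpace ℝ (Fin n)) S]
  [RiemannianBundle (fun x : S ↦ TangentSpace (𝓡 n) x)]

/-- A `C¹` curve on `[a, b]`, with `a < b`, whose speed is at most one. -/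
structure IsSubunitOn (σ : ℝ → S) (a b : ℝ) : Prop where
  lt : a < b
  contMDiffOn : ContMDiffOn 𝓘(ℝ, ℝ) (𝓡 n) 1 σ (Icc a b)
  norm_le : ∀ s ∈ Icc a b,
    ‖(mfderivWithin 𝓘(ℝ, ℝ) (𝓡 n) σ (Icc a b) s (1 : ℝ) : TangentSpace (𝓡 n) (σ s))‖ ≤ 1

namespace IsSubunitOn

variable {σ : ℝ → S} {a b : ℝ}

theorem mdifferentiableWithinAt (h : IsSubunitOn (n := n) σ a b) {s : ℝ} (hs : s ∈ Icc a b) :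
    MDifferentiableWithinAt 𝓘(ℝ, ℝ) (𝓡 n) σ (Icc a b) s :=
  h.contMDiffOn.mdifferentiableOn one_ne_zero s hs

theorem mono (h : IsSubunitOn (n := n) σ a b) {α β : ℝ} (hα : a ≤ α) (hαβ : α < β) (hβ : β ≤ b) :
    IsSubunitOn (n := n) σ α β where
  lt := hαβ
  contMDiffOn := h.contMDiffOn.mono (Icc_subset_Icc hα hβ)
  norm_le s hs := by
    have hs' : s ∈ Icc a b := Icc_subset_Icc hα hβ hs
    rw [mfderivWithin_subset (Icc_subset_Icc hα hβ)
      (uniqueDiffOn_Icc hαβ s hs).uniqueMDiffWithinAt (h.mdifferentiableWithinAt hs')]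
    exact h.norm_le s hs'

theorem pathELength_le (h : IsSubunitOn (n := n) σ a b) :
    pathELength (𝓡 n) σ a b ≤ ENNReal.ofReal (b - a) := by
  rw [pathELength_eq_lintegral_mfderivWithin_Icc]
  calc _ ≤ ∫⁻ _ in Icc a b, (1 : ENNReal) := by
        refine setLIntegral_mono measurable_const fun s hs ↦ ?_
        rw [← ofReal_norm]
        exact ENNReal.ofReal_le_one.2 (h.norm_le s hs)
    _ = _ := by simp

theorem riemannianEDist_le (h : IsSubunitOn (n := n) σ a b) {s t : ℝ} (hs : a ≤ s) (hst : s ≤ t)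
    (ht : t ≤ b) : riemannianEDist (𝓡 n) (σ s) (σ t) ≤ ENNReal.ofReal (t - s) := by
  rcases hst.eq_or_lt with rfl | hlt
  · rw [riemannianEDist_self]; exact zero_le
  · have h' := h.mono hs hlt ht
    exact (riemannianEDist_le_pathELength h'.contMDiffOn rfl rfl hst).trans h'.pathELength_le

end IsSubunitOn

variable [IsManifold (𝓡 n) ∞ S]
  [IsContMDiffRiemannianBundle (𝓡 n) ∞ (EuclideanSpace ℝ (Fin n))
      (fun x : S ↦ TangentSpace (𝓡 n) x)]

/-- The distance between the endpoints of a curve is at most half the sum of its duration and its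
energy, since a speed `x` satisfies `x ≤ (1 + x²) / 2`. -/
theorem riemannianEDist_le_energy (p : S) {c : ℝ → EuclideanSpace ℝ (Fin n)} {a b : ℝ}
    (hab : a < b) (hc : ContDiff ℝ 1 c) (hcU : MapsTo c (Icc a b) (extChartAt (𝓡 n) p).target) :
    riemannianEDist (𝓡 n) ((extChartAt (𝓡 n) p).symm (c a)) ((extChartAt (𝓡 n) p).symm (c b)) ≤
      ENNReal.ofReal (2⁻¹ * ((b - a) +
        ∫ s in a..b, chartMetric p (c s) (deriv c s) (deriv c s))) := by
  set σ : ℝ → S := fun s ↦ (extChartAt (𝓡 n) p).symm (c s) with hσ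
  have hσs : ContMDiffOn 𝓘(ℝ, ℝ) (𝓡 n) 1 σ (Icc a b) :=
    (contMDiffOn_extChartAt_symm p).comp (contMDiffOn_iff_contDiffOn.2 hc.contDiffOn) hcU
  have hφσ : EqOn (fun r ↦ extChartAt (𝓡 n) p (σ r)) c (Icc a b) := fun s hs ↦
    (extChartAt (𝓡 n) p).right_inv (hcU hs)
  have hcont : ContinuousOn (fun s ↦ 2⁻¹ * (1 + chartMetric p (c s) (deriv c s) (deriv c s)))
      (Icc a b) := by
    have h1 : ContinuousOn (deriv c) (Icc a b) := (hc.continuous_deriv le_rfl).continuousOn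
    have h2 : ContinuousOn (fun s ↦ chartMetric p (c s)) (Icc a b) :=
      (contDiffOn_chartMetric p).continuousOn.comp hc.continuous.continuousOn hcU
    exact continuousOn_const.mul (continuousOn_const.add ((h2.clm_apply h1).clm_apply h1))
  have speed : ∀ s ∈ Icc a b,
      ‖(mfderivWithin 𝓘(ℝ, ℝ) (𝓡 n) σ (Icc a b) s (1 : ℝ) : TangentSpace (𝓡 n) (σ s))‖ ^ 2 =
        chartMetric p (c s) (deriv c s) (deriv c s) := by
    intro s hs
    rw [norm_mfderivWithin_sq_eq_metricInChart p (hσs.mdifferentiableOn one_ne_zero s hs)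
      (uniqueDiffOn_Icc hab s hs) ((extChartAt (𝓡 n) p).map_target (hcU hs)),
      derivWithin_congr hφσ (hφσ hs),
      show extChartAt (𝓡 n) p (σ s) = c s from hφσ hs, chartMetric_apply,
      (hc.differentiable one_ne_zero s).derivWithin (uniqueDiffOn_Icc hab s hs)]
  refine (riemannianEDist_le_pathELength hσs rfl rfl hab.le).trans ?_
  rw [pathELength_eq_lintegral_mfderivWithin_Icc]
  calc _ ≤ ∫⁻ s in Icc a b,
          ENNReal.ofReal (2⁻¹ * (1 + chartMetric p (c s) (deriv c s) (deriv c s))) := by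
        refine setLIntegral_mono' measurableSet_Icc fun s hs ↦ ?_
        rw [← ofReal_norm, ← speed s hs]
        refine ENNReal.ofReal_le_ofReal ?_
        have amgm : ∀ x : ℝ, x ≤ 2⁻¹ * (1 + x ^ 2) := fun x ↦ by nlinarith [sq_nonneg (x - 1)]
        exact amgm _
    _ = ENNReal.ofReal (∫ s in Icc a b,
          2⁻¹ * (1 + chartMetric p (c s) (deriv c s) (deriv c s))) := by
        rw [ofReal_integral_eq_lintegral_ofReal hcont.integrableOn_Icc]
        refine (ae_restrict_iff' measurableSet_Icc).2 (Eventually.of_forall fun s hs ↦ ?_)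
        change 0 ≤ 2⁻¹ * (1 + chartMetric p (c s) (deriv c s) (deriv c s))
        rw [← speed s hs]
        positivity
    _ = _ := by
        rw [integral_Icc_eq_integral_Ioc, ← intervalIntegral.integral_of_le hab.le,
          intervalIntegral.integral_const_mul, intervalIntegral.integral_add
            intervalIntegrable_const, intervalIntegral.integral_const]
        · simp
        · have := ((hcont.const_smul (2 : ℝ)).sub (continuousOn_const (c := (1 : ℝ))))
          refine ContinuousOn.intervalIntegrable_of_Icc hab.le (this.congr fun s _ ↦ ?_)
          simp

/-- A possibly broken curve of speed at most one, contained in a chart domain, whose duration is the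
distance between its endpoints, is `C²` and satisfies the geodesic equation in that chart. -/
theorem geodesic_eq_of_minimizing_in_chart (p : S) {σ : ℝ → S} {a τ b : ℝ}
    (h₁ : IsSubunitOn (n := n) σ a τ) (h₂ : IsSubunitOn (n := n) σ τ b)
    (hp : MapsTo σ (Icc a b) (extChartAt (𝓡 n) p).source)
    (hd : ENNReal.ofReal (b - a) ≤ riemannianEDist (𝓡 n) (σ a) (σ b)) :
    let c : ℝ → EuclideanSpace ℝ (Fin n) := fun r ↦ extChartAt (𝓡 n) p (σ r)
    ContDiffOn ℝ 2 c (Icc a b) ∧ ∀ s ∈ Icc a b, ∀ z,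
      metricInChart p (c s) (derivWithin (derivWithin c (Icc a b)) (Icc a b) s) z
        + christoffelInChart p (c s) (derivWithin c (Icc a b) s) (derivWithin c (Icc a b) s) z
          = 0 := by
  intro c
  have haτ := h₁.lt
  have hτb := h₂.lt
  have hsub₁ : Icc a τ ⊆ Icc a b := Icc_subset_Icc_right hτb.le
  have hsub₂ : Icc τ b ⊆ Icc a b := Icc_subset_Icc_left haτ.le
  have hcU : MapsTo c (Icc a b) (extChartAt (𝓡 n) p).target := fun s hs ↦
    (extChartAt (𝓡 n) p).map_source (hp hs)
  have hψ : ∀ s ∈ Icc a b, (extChartAt (𝓡 n) p).symm (c s) = σ s := fun s hs ↦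
    (extChartAt (𝓡 n) p).left_inv (hp hs)
  have smooth : ∀ {x y}, IsSubunitOn (n := n) σ x y → Icc x y ⊆ Icc a b →
      ContDiffOn ℝ 1 c (Icc x y) := fun h hsub ↦ contMDiffOn_iff_contDiffOn.1
    ((contMDiffOn_extChartAt (I := 𝓡 n) (n := 1) (x := p)).comp h.contMDiffOn fun s hs ↦ by
      rw [← extChartAt_source (𝓡 n) p]; exact hp (hsub hs))
  obtain ⟨c₁, hc₁, e₁, d₁⟩ := exists_contDiff_eqOn_Icc haτ (smooth h₁ hsub₁)
  obtain ⟨c₂, hc₂, e₂, d₂⟩ := exists_contDiff_eqOn_Icc hτb (smooth h₂ hsub₂)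
  have hU₁ : MapsTo c₁ (Icc a τ) (extChartAt (𝓡 n) p).target := fun s hs ↦
    e₁ hs ▸ hcU (hsub₁ hs)
  have hU₂ : MapsTo c₂ (Icc τ b) (extChartAt (𝓡 n) p).target := fun s hs ↦
    e₂ hs ▸ hcU (hsub₂ hs)
  -- The speed is at most one, so the energy of the curve is at most its duration.
  have upper : ∀ {x y : ℝ} {c' : ℝ → EuclideanSpace ℝ (Fin n)} (h : IsSubunitOn (n := n) σ x y),
      Icc x y ⊆ Icc a b → ContDiff ℝ 1 c' → EqOn c' c (Icc x y) →
      (∀ s, deriv c' s = derivWithin c (Icc x y) (projIcc x y h.lt.le s)) →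
      ∫ s in x..y, chartMetric p (c' s) (deriv c' s) (deriv c' s) ≤ y - x := by
    intro x y c' h hsub hc' e d
    have h1 : ContinuousOn (deriv c') (Icc x y) := (hc'.continuous_deriv le_rfl).continuousOn
    have h2 : ContinuousOn (fun s ↦ chartMetric p (c' s)) (Icc x y) :=
      (contDiffOn_chartMetric p).continuousOn.comp hc'.continuous.continuousOn
        fun s hs ↦ e hs ▸ hcU (hsub hs)
    calc _ ≤ ∫ s in x..y, (1 : ℝ) := by
          refine intervalIntegral.integral_mono_on h.lt.le
            (ContinuousOn.intervalIntegrable_of_Icc h.lt.le ((h2.clm_apply h1).clm_apply h1))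
            intervalIntegrable_const fun s hs ↦ ?_
          have := norm_mfderivWithin_sq_eq_metricInChart p (h.mdifferentiableWithinAt hs)
            (uniqueDiffOn_Icc h.lt s hs) (hp (hsub hs))
          rw [d, projIcc_of_mem h.lt.le hs, e hs, chartMetric_apply]
          refine this.symm.trans_le ?_
          exact pow_le_one₀ (norm_nonneg _) (h.norm_le s hs)
      _ = _ := by simp
  have key := contDiffOn_two_of_energy_min (isOpen_extChartAt_target p)
    ((contDiffOn_chartMetric p).of_le (by simp)) (fun u _ v w ↦ metricInChart_comm p u v w)
    (fun u hu v hv ↦ metricInChart_pos p hu hv) haτ hτb hc₁ hc₂ e₁.symm e₂.symm hcU (by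
      intro η₁ η₂ hη₁ hη₂ ha hτ hb
      filter_upwards [eventually_mapsTo_add_smul (isOpen_extChartAt_target p) hc₁.continuous
        hη₁.continuous hU₁, eventually_mapsTo_add_smul (isOpen_extChartAt_target p) hc₂.continuous
        hη₂.continuous hU₂] with ε m₁ m₂
      have E₁ := riemannianEDist_le_energy p (c := fun s ↦ c₁ s + ε • η₁ s) haτ
        (hc₁.add (hη₁.const_smul ε)) m₁
      have E₂ := riemannianEDist_le_energy p (c := fun s ↦ c₂ s + ε • η₂ s) hτb
        (hc₂.add (hη₂.const_smul ε)) m₂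
      have D : ∀ {c' η : ℝ → EuclideanSpace ℝ (Fin n)}, ContDiff ℝ 1 c' → ContDiff ℝ 1 η → ∀ s,
          deriv (fun s ↦ c' s + ε • η s) s = deriv c' s + ε • deriv η s := fun hc' hη s ↦
        (((hc'.differentiable one_ne_zero s).hasDerivAt).add
          (((hη.differentiable one_ne_zero s).hasDerivAt).const_smul ε)).deriv
      simp only [D hc₁ hη₁, D hc₂ hη₂] at E₁ E₂
      have τ₁ : τ ∈ Icc a τ := right_mem_Icc.2 haτ.le
      have τ₂ : τ ∈ Icc τ b := left_mem_Icc.2 hτb.le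
      rw [ha, smul_zero, add_zero, e₁ (left_mem_Icc.2 haτ.le),
        hψ a (left_mem_Icc.2 (haτ.trans hτb).le)] at E₁
      rw [hb, smul_zero, add_zero, e₂ (right_mem_Icc.2 hτb.le),
        hψ b (right_mem_Icc.2 (haτ.trans hτb).le), ← hτ, e₂ τ₂, ← e₁ τ₁] at E₂
      -- A variation of energy `e` gives `b - a ≤ ((b - a) + e) / 2`, that is `b - a ≤ e`.
      have E := hd.trans (riemannianEDist_triangle.trans (add_le_add E₁ E₂))
      have nonneg : ∀ {x y : ℝ} {c' v : ℝ → EuclideanSpace ℝ (Fin n)}, x ≤ y →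
          MapsTo c' (Icc x y) (extChartAt (𝓡 n) p).target →
          0 ≤ ∫ s in x..y, chartMetric p (c' s) (v s) (v s) := fun hxy hm ↦
        intervalIntegral.integral_nonneg hxy fun s _ ↦
          metricInChart_self_nonneg p _ _
      have N₁ := nonneg (v := fun s ↦ deriv c₁ s + ε • deriv η₁ s) haτ.le m₁
      have N₂ := nonneg (v := fun s ↦ deriv c₂ s + ε • deriv η₂ s) hτb.le m₂
      rw [← ENNReal.ofReal_add (by linarith) (by linarith),
        ENNReal.ofReal_le_ofReal_iff (by linarith)] at E
      have U₁ := upper h₁ hsub₁ hc₁ e₁ d₁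
      have U₂ := upper h₂ hsub₂ hc₂ e₂ d₂
      linarith)
  refine ⟨key.1, fun s hs z ↦ ?_⟩
  rw [christoffelInChart_self p (hcU hs)]
  exact key.2 s hs z

end Subunit

/-! ### Minimizing curves are geodesics -/

section Geodesics

open MeasureTheory Manifold Filter

/-- A neighborhood of `s` in `[a, b]` contains a nondegenerate interval `[α, β]` which is still a
neighborhood of `s` in `[a, b]`, including when `s` is an endpoint. -/
theorem exists_Icc_subset_of_mem_nhdsWithin {a b s : ℝ} (hab : a < b) (hs : s ∈ Icc a b)
    {N : Set ℝ} (hN : N ∈ 𝓝[Icc a b] s) :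
    ∃ α β, a ≤ α ∧ α < β ∧ β ≤ b ∧ s ∈ Icc α β ∧ (a < s → α < s) ∧ (s < b → s < β) ∧
      Icc α β ⊆ N ∧ Icc α β ∈ 𝓝[Icc a b] s := by
  obtain ⟨δ, hδ, h⟩ := (nhdsWithin_hasBasis Metric.nhds_basis_closedBall _).mem_iff.1 hN
  rw [Real.closedBall_eq_Icc] at h
  have heq : Icc (s - δ) (s + δ) ∩ Icc a b = Icc (max a (s - δ)) (min b (s + δ)) := by
    rw [Icc_inter_Icc, sup_comm, inf_comm]
  rw [heq] at h
  refine ⟨max a (s - δ), min b (s + δ), le_max_left _ _, ?_, min_le_left _ _,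
    ⟨max_le hs.1 (by linarith), le_min hs.2 (by linarith)⟩, fun h ↦ max_lt h (by linarith),
    fun h ↦ lt_min h (by linarith), h, ?_⟩
  · exact max_lt (lt_min hab (by linarith [hs.1])) (lt_min (by linarith [hs.2]) (by linarith))
  · rw [← heq, inter_comm]
    exact inter_mem_nhdsWithin _ (Icc_mem_nhds (by linarith) (by linarith))

theorem Icc_left_mem_nhdsWithin {a τ b s : ℝ} (h : s < τ) :
    Icc a τ ∈ 𝓝[Icc a b] s := by
  filter_upwards [inter_mem_nhdsWithin (Icc a b) (Iio_mem_nhds h)] with r hr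
  exact ⟨hr.1.1, hr.2.le⟩

theorem Icc_right_mem_nhdsWithin {a τ b s : ℝ} (h : τ < s) :
    Icc τ b ∈ 𝓝[Icc a b] s := by
  filter_upwards [inter_mem_nhdsWithin (Icc a b) (Ioi_mem_nhds h)] with r hr
  exact ⟨hr.2.le, hr.1.2⟩

variable {n : ℕ} {S : Type*} [TopologicalSpace S] [ChartedSpace (EuclideanSpace ℝ (Fin n)) S]
  [RiemannianBundle (fun x : S ↦ TangentSpace (𝓡 n) x)]

/-- If going from `x` to `w` through `y` and `z` takes at most `r` from `x` to `y` and `t` from `z`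
to `w`, while `x` and `w` are at distance at least `r + s + t`, then `y` and `z` are at distance at
least `s`: pieces of minimizing curves are minimizing. -/
theorem ofReal_le_riemannianEDist_of_subsegment {x y z w : S} {r s t : ℝ} (hr : 0 ≤ r)
    (hs : 0 ≤ s) (ht : 0 ≤ t) (hxy : riemannianEDist (𝓡 n) x y ≤ ENNReal.ofReal r)
    (hzw : riemannianEDist (𝓡 n) z w ≤ ENNReal.ofReal t)
    (hxw : ENNReal.ofReal (r + s + t) ≤ riemannianEDist (𝓡 n) x w) :
    ENNReal.ofReal s ≤ riemannianEDist (𝓡 n) y z := by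
  have h : ENNReal.ofReal (r + s + t) ≤
      ENNReal.ofReal r + riemannianEDist (𝓡 n) y z + ENNReal.ofReal t :=
    hxw.trans ((riemannianEDist_triangle (y := z)).trans
      (add_le_add ((riemannianEDist_triangle (y := y)).trans (add_le_add hxy le_rfl)) hzw))
  rw [ENNReal.ofReal_add (by positivity) ht, ENNReal.ofReal_add hr hs] at h
  rwa [ENNReal.add_le_add_iff_right ENNReal.ofReal_ne_top,
    ENNReal.add_le_add_iff_left ENNReal.ofReal_ne_top] at h

variable [IsManifold (𝓡 n) ∞ S]

omit [RiemannianBundle (fun x : S ↦ TangentSpace (𝓡 n) x)] in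
theorem contMDiffOn_of_contDiffOn_extChartAt (p : S) {σ : ℝ → S} {s : Set ℝ}
    (hp : MapsTo σ s (extChartAt (𝓡 n) p).source)
    (h : ContDiffOn ℝ 2 (fun r ↦ extChartAt (𝓡 n) p (σ r)) s) :
    ContMDiffOn 𝓘(ℝ, ℝ) (𝓡 n) 2 σ s :=
  ((contMDiffOn_extChartAt_symm (n := 2) p).comp (contMDiffOn_iff_contDiffOn.2 h) fun _ hr ↦
    (extChartAt (𝓡 n) p).map_source (hp hr)).congr fun _ hr ↦
      ((extChartAt (𝓡 n) p).left_inv (hp hr)).symm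

omit [RiemannianBundle (fun x : S ↦ TangentSpace (𝓡 n) x)] [IsManifold (𝓡 n) ∞ S] in
theorem contDiffWithinAt_extChartAt_comp (p : S) {σ : ℝ → S} {s : Set ℝ} {t : ℝ} {k : WithTop ℕ∞}
    [IsManifold (𝓡 n) k S]
    (hp : σ t ∈ (extChartAt (𝓡 n) p).source) (h : ContMDiffWithinAt 𝓘(ℝ, ℝ) (𝓡 n) k σ s t) :
    ContDiffWithinAt ℝ k (fun r ↦ extChartAt (𝓡 n) p (σ r)) s t :=
  contMDiffWithinAt_iff_contDiffWithinAt.1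
    ((contMDiffAt_extChartAt' (by rwa [← extChartAt_source (𝓡 n) p])).comp_contMDiffWithinAt t h)

variable [IsContMDiffRiemannianBundle (𝓡 n) ∞ (EuclideanSpace ℝ (Fin n))
      (fun x : S ↦ TangentSpace (𝓡 n) x)]

/-- A minimizing broken curve has no corner. -/
theorem IsSubunitOn.union {σ : ℝ → S} {a τ b : ℝ} (h₁ : IsSubunitOn (n := n) σ a τ)
    (h₂ : IsSubunitOn (n := n) σ τ b)
    (hd : ENNReal.ofReal (b - a) ≤ riemannianEDist (𝓡 n) (σ a) (σ b)) :
    IsSubunitOn (n := n) σ a b := by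
  have haτ := h₁.lt
  have hτb := h₂.lt
  have hab := haτ.trans hτb
  have hτ : τ ∈ Icc a b := ⟨haτ.le, hτb.le⟩
  have hcont : ContinuousOn σ (Icc a b) := by
    rw [← Icc_union_Icc_eq_Icc haτ.le hτb.le]
    exact h₁.contMDiffOn.continuousOn.union_of_isClosed h₂.contMDiffOn.continuousOn
      isClosed_Icc isClosed_Icc
  obtain ⟨α, β, hα, hαβ, hβ, -, hατ, hτβ, hsub, hnhds⟩ :=
    exists_Icc_subset_of_mem_nhdsWithin hab hτ
      ((hcont τ hτ).preimage_mem_nhdsWithin (extChartAt_source_mem_nhds (I := 𝓡 n) (σ τ)))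
  have local_geodesic := geodesic_eq_of_minimizing_in_chart (σ τ) (h₁.mono hα (hατ haτ) le_rfl)
    (h₂.mono le_rfl (hτβ hτb) hβ) hsub (ofReal_le_riemannianEDist_of_subsegment
      (r := α - a) (t := b - β) (by linarith) (by linarith) (by linarith)
      (h₁.riemannianEDist_le le_rfl hα (hατ haτ).le)
      (h₂.riemannianEDist_le (hτβ hτb).le hβ le_rfl)
      (by rwa [show α - a + (β - α) + (b - β) = b - a by ring]))
  have hC2 := contMDiffOn_of_contDiffOn_extChartAt (σ τ) hsub local_geodesic.1
  have hC1 : ContMDiffOn 𝓘(ℝ, ℝ) (𝓡 n) 1 σ (Icc a b) := by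
    intro s hs
    rcases lt_trichotomy s τ with h | rfl | h
    · exact (h₁.contMDiffOn s ⟨hs.1, h.le⟩).mono_of_mem_nhdsWithin
        (Icc_left_mem_nhdsWithin h)
    · exact ((hC2 s ⟨(hατ haτ).le, (hτβ hτb).le⟩).of_le one_le_two).mono_of_mem_nhdsWithin hnhds
    · exact (h₂.contMDiffOn s ⟨h.le, hs.2⟩).mono_of_mem_nhdsWithin
        (Icc_right_mem_nhdsWithin h)
  refine ⟨hab, hC1, fun s hs ↦ ?_⟩
  have hmd := hC1.mdifferentiableOn one_ne_zero s hs
  rcases le_total s τ with h | h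
  · rw [← mfderivWithin_subset (Icc_subset_Icc_right hτb.le)
      (uniqueDiffOn_Icc haτ s ⟨hs.1, h⟩).uniqueMDiffWithinAt hmd]
    exact h₁.norm_le s ⟨hs.1, h⟩
  · rw [← mfderivWithin_subset (Icc_subset_Icc_left haτ.le)
      (uniqueDiffOn_Icc hτb s ⟨h, hs.2⟩).uniqueMDiffWithinAt hmd]
    exact h₂.norm_le s ⟨h, hs.2⟩

/-- A curve of speed at most one whose duration is the distance between its endpoints is a
minimizing geodesic. -/
theorem IsSubunitOn.isMinimizingGeodesicOn {σ : ℝ → S} {a b : ℝ} (h : IsSubunitOn (n := n) σ a b)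
    (hd : ENNReal.ofReal (b - a) ≤ riemannianEDist (𝓡 n) (σ a) (σ b)) :
    IsMinimizingGeodesicOn (n := n) σ a b := by
  have hab := h.lt
  have hu := uniqueDiffOn_Icc hab
  have key : ∀ s ∈ Icc a b, ContMDiffWithinAt 𝓘(ℝ, ℝ) (𝓡 n) 2 σ (Icc a b) s ∧
      ∀ z, metricInChart (σ s) (extChartAt (𝓡 n) (σ s) (σ s))
        (derivWithin (derivWithin (fun r ↦ extChartAt (𝓡 n) (σ s) (σ r)) (Icc a b)) (Icc a b) s) z
        + christoffelInChart (σ s) (extChartAt (𝓡 n) (σ s) (σ s))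
          (derivWithin (fun r ↦ extChartAt (𝓡 n) (σ s) (σ r)) (Icc a b) s)
          (derivWithin (fun r ↦ extChartAt (𝓡 n) (σ s) (σ r)) (Icc a b) s) z = 0 := by
    intro s hs
    obtain ⟨α, β, hα, hαβ, hβ, hsαβ, -, -, hsub, hnhds⟩ :=
      exists_Icc_subset_of_mem_nhdsWithin hab hs
        ((h.contMDiffOn.continuousOn s hs).preimage_mem_nhdsWithin
          (extChartAt_source_mem_nhds (I := 𝓡 n) (σ s)))
    have hα' : α < (α + β) / 2 := by linarith
    have hβ' : (α + β) / 2 < β := by linarith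
    obtain ⟨hC2, heq⟩ := geodesic_eq_of_minimizing_in_chart (σ s)
      (h.mono hα hα' (hβ'.le.trans hβ)) (h.mono (hα.trans hα'.le) hβ' hβ) hsub
      (ofReal_le_riemannianEDist_of_subsegment
        (r := α - a) (t := b - β) (by linarith) (by linarith) (by linarith)
        (h.riemannianEDist_le le_rfl hα (hαβ.le.trans hβ))
        (h.riemannianEDist_le (hα.trans hαβ.le) hβ le_rfl)
        (by rwa [show α - a + (β - α) + (b - β) = b - a by ring]))
    refine ⟨((contMDiffOn_of_contDiffOn_extChartAt (σ s) hsub hC2) s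
      hsαβ).mono_of_mem_nhdsWithin hnhds, fun z ↦ ?_⟩
    set c : ℝ → EuclideanSpace ℝ (Fin n) := fun r ↦ extChartAt (𝓡 n) (σ s) (σ r) with hc
    have hu' := uniqueDiffOn_Icc hαβ
    have e1 : EqOn (derivWithin c (Icc a b)) (derivWithin c (Icc α β)) (Icc α β) := by
      intro r hr
      refine (derivWithin_subset (Icc_subset_Icc hα hβ) (hu' r hr) ?_).symm
      exact (contDiffWithinAt_extChartAt_comp (σ s) (hsub hr)
        (h.contMDiffOn r (Icc_subset_Icc hα hβ hr))).differentiableWithinAt one_ne_zero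
    have hdiff : DifferentiableWithinAt ℝ (derivWithin c (Icc α β)) (Icc α β) s :=
      (hC2.derivWithin hu' (m := 1) one_add_one_eq_two.le).differentiableOn one_ne_zero s hsαβ
    have e2 : derivWithin (derivWithin c (Icc a b)) (Icc a b) s =
        derivWithin (derivWithin c (Icc α β)) (Icc α β) s := by
      rw [derivWithin_of_mem_nhdsWithin hnhds (hu s hs) (hdiff.congr e1 (e1 hsαβ)),
        derivWithin_congr e1 (e1 hsαβ)]
    rw [e2, e1 hsαβ]
    exact heq s hsαβ z
  refine ⟨⟨hab, fun s hs ↦ (key s hs).1, fun s hs ↦ (key s hs).2⟩, ?_⟩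
  exact le_antisymm (h.pathELength_le.trans hd)
    (riemannianEDist_le_pathELength h.contMDiffOn rfl rfl hab.le)

set_option maxSynthPendingDepth 3 in
/-- A geodesic has constant speed: by the geodesic equation applied to `z = c'`, the derivative of
`G(c)(c', c')` vanishes. -/
theorem IsGeodesicOn.exists_norm_mfderivWithin_eq {σ : ℝ → S} {a b : ℝ}
    (h : IsGeodesicOn (n := n) σ a b) : ∃ k : ℝ, ∀ s ∈ Icc a b,
      ‖(mfderivWithin 𝓘(ℝ, ℝ) (𝓡 n) σ (Icc a b) s (1 : ℝ) : TangentSpace (𝓡 n) (σ s))‖ = k := by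
  have hab := h.lt
  have hu := uniqueDiffOn_Icc hab
  set f : ℝ → ℝ := fun s ↦
    ‖(mfderivWithin 𝓘(ℝ, ℝ) (𝓡 n) σ (Icc a b) s (1 : ℝ) : TangentSpace (𝓡 n) (σ s))‖ ^ 2 with hf
  have key : ∀ s ∈ Icc a b, HasDerivWithinAt f 0 (Icc a b) s := by
    intro s hs
    obtain ⟨α, β, hα, hαβ, hβ, hsαβ, -, -, hsub, hnhds⟩ :=
      exists_Icc_subset_of_mem_nhdsWithin hab hs
        ((h.contMDiffOn.continuousOn s hs).preimage_mem_nhdsWithin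
          (extChartAt_source_mem_nhds (I := 𝓡 n) (σ s)))
    have hu' := uniqueDiffOn_Icc hαβ
    have hIcc : Icc α β ⊆ Icc a b := Icc_subset_Icc hα hβ
    have hgeo := h.geodesic_eq s hs
    set c : ℝ → EuclideanSpace ℝ (Fin n) := fun r ↦ extChartAt (𝓡 n) (σ s) (σ r) with hc
    set c' : ℝ → EuclideanSpace ℝ (Fin n) := derivWithin c (Icc a b) with hc'
    have hC2 : ∀ r ∈ Icc α β, ContDiffWithinAt ℝ 2 c (Icc a b) r := fun r hr ↦
      contDiffWithinAt_extChartAt_comp (σ s) (hsub hr) (h.contMDiffOn r (hIcc hr))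
    have dc : HasDerivWithinAt c (c' s) (Icc α β) s :=
      ((hC2 s hsαβ).differentiableWithinAt two_ne_zero).hasDerivWithinAt.mono hIcc
    have e1 : EqOn c' (derivWithin c (Icc α β)) (Icc α β) := fun r hr ↦
      (derivWithin_subset hIcc (hu' r hr)
        ((hC2 r hr).differentiableWithinAt two_ne_zero)).symm
    have hdiff : DifferentiableWithinAt ℝ c' (Icc α β) s := by
      have h2 : ContDiffOn ℝ 2 c (Icc α β) := fun r hr ↦ (hC2 r hr).mono hIcc
      exact ((h2.derivWithin hu' (m := 1) one_add_one_eq_two.le).differentiableOn one_ne_zero s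
        hsαβ).congr e1 (e1 hsαβ)
    have dc' : HasDerivWithinAt c' (derivWithin c' (Icc a b) s) (Icc α β) s := by
      rw [derivWithin_of_mem_nhdsWithin hnhds (hu s hs) hdiff]
      exact hdiff.hasDerivWithinAt
    have hmem : c s ∈ (extChartAt (𝓡 n) (σ s)).target := mem_extChartAt_target (σ s)
    have dG : HasDerivWithinAt (fun r ↦ chartMetric (σ s) (c r))
        (fderiv ℝ (chartMetric (σ s)) (c s) (c' s)) (Icc α β) s :=
      (((contDiffOn_chartMetric (σ s)).contDiffAt ((isOpen_extChartAt_target (σ s)).mem_nhds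
        hmem)).differentiableAt (by simp)).hasFDerivAt.comp_hasDerivWithinAt s dc
    have d1 : HasDerivWithinAt (fun r ↦ chartMetric (σ s) (c r) (c' r))
        (fderiv ℝ (chartMetric (σ s)) (c s) (c' s) (c' s)
          + chartMetric (σ s) (c s) (derivWithin c' (Icc a b) s)) (Icc α β) s := dG.clm_apply dc'
    have d2 := d1.clm_apply dc'
    have hval := hgeo (c' s)
    rw [christoffelInChart_self (σ s) hmem, fderivQuadratic_apply] at hval
    have hzero : (fderiv ℝ (chartMetric (σ s)) (c s) (c' s) (c' s)
          + chartMetric (σ s) (c s) (derivWithin c' (Icc a b) s)) (c' s)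
          + chartMetric (σ s) (c s) (c' s) (derivWithin c' (Icc a b) s) = 0 := by
      have hsymm : chartMetric (σ s) (c s) (c' s) (derivWithin c' (Icc a b) s) =
        chartMetric (σ s) (c s) (derivWithin c' (Icc a b) s) (c' s) := metricInChart_comm _ _ _ _
      rw [hsymm, add_apply, chartMetric_apply]
      linarith
    rw [hzero] at d2
    refine (d2.congr (fun r hr ↦ ?_) ?_).mono_of_mem_nhdsWithin hnhds
    · exact norm_mfderivWithin_sq_eq_metricInChart (σ s)
        (h.contMDiffOn.mdifferentiableOn two_ne_zero r (hIcc hr)) (hu r (hIcc hr)) (hsub hr)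
    · exact norm_mfderivWithin_sq_eq_metricInChart (σ s)
        (h.contMDiffOn.mdifferentiableOn two_ne_zero s hs) (hu s hs) (hsub hsαβ)
  refine ⟨√(f a), fun s hs ↦ ?_⟩
  have hconst := constant_of_derivWithin_zero (fun s hs ↦ (key s hs).differentiableWithinAt)
    (fun s hs ↦ (key s (Ico_subset_Icc_self hs)).derivWithin (hu s (Ico_subset_Icc_self hs))) s hs
  rw [← hconst, hf]
  exact (Real.sqrt_sq (norm_nonneg _)).symm

end Geodesics

/-! ### Reparametrization -/

section Reparametrization

open MeasureTheory Manifold Filter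

/-- A `C¹` function on `[a, b]` with positive derivative is the restriction of a diffeomorphism of
the line; here `θ` is the inverse of this diffeomorphism. -/
theorem exists_contDiff_leftInverse {t : ℝ → ℝ} {a b : ℝ} (hab : a < b)
    (ht : ContDiffOn ℝ 1 t (Icc a b)) (hpos : ∀ s ∈ Icc a b, 0 < derivWithin t (Icc a b) s) :
    t a < t b ∧ ∃ θ : ℝ → ℝ, ContDiff ℝ 1 θ ∧ θ (t a) = a ∧ θ (t b) = b ∧
      MapsTo θ (Icc (t a) (t b)) (Icc a b) ∧
      ∀ r ∈ Icc (t a) (t b), deriv θ r = (derivWithin t (Icc a b) (θ r))⁻¹ := by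
  obtain ⟨T, hT, hTt, hT'⟩ := exists_contDiff_eqOn_Icc hab ht
  have ha : a ∈ Icc a b := left_mem_Icc.2 hab.le
  have hb : b ∈ Icc a b := right_mem_Icc.2 hab.le
  obtain ⟨s₀, hs₀, hmin⟩ := isCompact_Icc.exists_isMinOn (nonempty_Icc.2 hab.le)
    (ht.continuousOn_derivWithin (uniqueDiffOn_Icc hab) le_rfl)
  set m : ℝ := derivWithin t (Icc a b) s₀ with hm
  have m_pos : 0 < m := hpos s₀ hs₀
  have hmT : ∀ s, m ≤ deriv T s := fun s ↦ by
    rw [hT']; exact hmin (projIcc a b hab.le s).2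
  have hTpos : ∀ s, 0 < deriv T s := fun s ↦ m_pos.trans_le (hmT s)
  have hTmono : StrictMono T := strictMono_of_deriv_pos hTpos
  have hTd : ∀ s, HasDerivAt T (deriv T s) s := fun s ↦
    (hT.differentiable one_ne_zero s).hasDerivAt
  -- The slope of `T` is at least `m`, so `T` is onto.
  have hsub : Monotone fun s ↦ T s - m * s := by
    refine monotone_of_deriv_nonneg
      (fun s ↦ ((hTd s).sub ((hasDerivAt_id s).const_mul m)).differentiableAt) fun s ↦ ?_
    have : HasDerivAt (fun s ↦ T s - m * s) (deriv T s - m * 1) s :=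
      (hTd s).sub ((hasDerivAt_id s).const_mul m)
    rw [this.deriv]
    linarith [hmT s]
  have htop : Tendsto T atTop atTop := by
    refine tendsto_atTop_mono' atTop ?_
      (tendsto_atTop_add_const_left atTop (T 0) (tendsto_id.const_mul_atTop m_pos))
    filter_upwards [eventually_ge_atTop 0] with s hs
    have := hsub hs
    simp only [id] at *
    linarith
  have hbot : Tendsto T atBot atBot := by
    refine tendsto_atBot_mono' atBot ?_
      (tendsto_atBot_add_const_left atBot (T 0) (tendsto_id.const_mul_atBot m_pos))
    filter_upwards [eventually_le_atBot 0] with s hs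
    have := hsub hs
    simp only [id] at *
    linarith
  set e : ℝ ≃ₜ ℝ := (hTmono.orderIsoOfSurjective T
    (hT.continuous.surjective htop hbot)).toHomeomorph with he
  have eT : ∀ s, e s = T s := fun s ↦ rfl
  have hθ : ContDiff ℝ 1 e.symm :=
    e.contDiff_symm_deriv (fun s ↦ (hTpos s).ne') hTd hT
  have hθT : ∀ s, e.symm (T s) = s := fun s ↦ e.symm_apply_apply s
  have hTθ : ∀ r, T (e.symm r) = r := fun r ↦ e.apply_symm_apply r
  have hmaps : MapsTo e.symm (Icc (t a) (t b)) (Icc a b) := by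
    intro r hr
    rw [← hTt ha, ← hTt hb, ← hTθ r] at hr
    exact ⟨hTmono.le_iff_le.1 hr.1, hTmono.le_iff_le.1 hr.2⟩
  refine ⟨?_, e.symm, hθ, ?_, ?_, hmaps, fun r hr ↦ ?_⟩
  · rw [← hTt ha, ← hTt hb]; exact hTmono hab
  · rw [← hTt ha, hθT]
  · rw [← hTt hb, hθT]
  · have h1 : HasDerivAt e.symm (deriv T (e.symm r))⁻¹ r :=
      HasDerivAt.of_local_left_inverse hθ.continuous.continuousAt (hTd _) (hTpos _).ne'
        (Eventually.of_forall hTθ)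
    rw [h1.deriv, hT', projIcc_of_mem hab.le (hmaps hr)]

variable {n : ℕ} {S : Type*} [TopologicalSpace S] [ChartedSpace (EuclideanSpace ℝ (Fin n)) S]

/-- The velocity of a reparametrized curve. -/
theorem mfderivWithin_comp_apply_one {σ : ℝ → S} {f : ℝ → ℝ} {s t : Set ℝ} {r : ℝ}
    (hσ : MDifferentiableWithinAt 𝓘(ℝ, ℝ) (𝓡 n) σ t (f r)) (hf : DifferentiableWithinAt ℝ f s r)
    (hst : MapsTo f s t) (hr : UniqueDiffWithinAt ℝ s r) :
    mfderivWithin 𝓘(ℝ, ℝ) (𝓡 n) (σ ∘ f) s r (1 : ℝ) =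
      derivWithin f s r • mfderivWithin 𝓘(ℝ, ℝ) (𝓡 n) σ t (f r) (1 : ℝ) := by
  have h := mfderivWithin_comp r hσ hf.mdifferentiableWithinAt hst hr.uniqueMDiffWithinAt
  rw [mfderivWithin_eq_fderivWithin] at h
  have h1 : mfderivWithin 𝓘(ℝ, ℝ) (𝓡 n) (σ ∘ f) s r (1 : ℝ) =
      mfderivWithin 𝓘(ℝ, ℝ) (𝓡 n) σ t (f r) (fderivWithin ℝ f s r (1 : ℝ)) :=
    DFunLike.congr_fun h (1 : ℝ)
  have h2 : fderivWithin ℝ f s r (1 : ℝ) = derivWithin f s r • (1 : ℝ) := by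
    rw [fderivWithin_derivWithin, smul_eq_mul, mul_one]
  rw [h1, h2]
  exact (mfderivWithin 𝓘(ℝ, ℝ) (𝓡 n) σ t (f r)).map_smul (derivWithin f s r) (1 : ℝ)

variable [RiemannianBundle (fun x : S ↦ TangentSpace (𝓡 n) x)]

theorem IsSubunitOn.congr {σ σ' : ℝ → S} {a b : ℝ} (h : IsSubunitOn (n := n) σ a b)
    (heq : EqOn σ' σ (Icc a b)) : IsSubunitOn (n := n) σ' a b := by
  refine ⟨h.lt, h.contMDiffOn.congr heq, fun s hs ↦ ?_⟩
  -- The two speeds are norms of the same vector, in tangent spaces at provably equal points.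
  have transport : ∀ {x y : S} (v : EuclideanSpace ℝ (Fin n)), x = y →
      @norm (TangentSpace (𝓡 n) x) _ v = @norm (TangentSpace (𝓡 n) y) _ v := by
    rintro x y v rfl; rfl
  rw [mfderivWithin_congr_of_mem heq hs]
  exact (transport _ (heq hs)).trans_le (h.norm_le s hs)

/-- A curve whose speed is dominated by the derivative of a time function has speed at most one when
reparametrized by this time function. -/
theorem exists_isSubunitOn_of_norm_mfderivWithin_le {σ : ℝ → S} {t : ℝ → ℝ} {a b : ℝ} (hab : a < b)
    (ht : ContDiffOn ℝ 1 t (Icc a b)) (hpos : ∀ s ∈ Icc a b, 0 < derivWithin t (Icc a b) s)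
    (hσ : ContMDiffOn 𝓘(ℝ, ℝ) (𝓡 n) 1 σ (Icc a b))
    (hle : ∀ s ∈ Icc a b, ‖(mfderivWithin 𝓘(ℝ, ℝ) (𝓡 n) σ (Icc a b) s (1 : ℝ) :
      TangentSpace (𝓡 n) (σ s))‖ ≤ derivWithin t (Icc a b) s) :
    ∃ c : ℝ → S, IsSubunitOn (n := n) c (t a) (t b) ∧ c (t a) = σ a ∧ c (t b) = σ b := by
  obtain ⟨htab, θ, hθ, ha, hb, hmaps, hθ'⟩ := exists_contDiff_leftInverse hab ht hpos
  refine ⟨σ ∘ θ, ⟨htab, hσ.comp (contMDiffOn_iff_contDiffOn.2 hθ.contDiffOn) hmaps,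
    fun r hr ↦ ?_⟩, congrArg σ ha, congrArg σ hb⟩
  have hu := uniqueDiffOn_Icc htab r hr
  rw [mfderivWithin_comp_apply_one (hσ.mdifferentiableOn one_ne_zero _ (hmaps hr))
    (hθ.differentiable one_ne_zero r).differentiableWithinAt hmaps hu,
    (hθ.differentiable one_ne_zero r).derivWithin hu, hθ' r hr]
  have hp := hpos _ (hmaps hr)
  refine (norm_smul_le _ _).trans ?_
  rw [norm_inv, Real.norm_of_nonneg hp.le, inv_mul_le_iff₀ hp, mul_one]
  exact hle _ (hmaps hr)

end Reparametrization

/-! ### Causal curves of the static spacetime -/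

section StaticCausality

open MeasureTheory Manifold Filter

variable {n : ℕ} {S : Type*} [TopologicalSpace S] [ChartedSpace (EuclideanSpace ℝ (Fin n)) S]

theorem dTime_mfderivWithin {γ : ℝ → ℝ × S} {s : Set ℝ} {r : ℝ}
    (hγ : MDifferentiableWithinAt 𝓘(ℝ, ℝ) (𝓘(ℝ, ℝ).prod (𝓡 n)) γ s r)
    (hr : UniqueDiffWithinAt ℝ s r) :
    dTime (γ r) (mfderivWithin 𝓘(ℝ, ℝ) (𝓘(ℝ, ℝ).prod (𝓡 n)) γ s r (1 : ℝ)) =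
      derivWithin (fun r ↦ (γ r).1) s r := by
  have h := mfderiv_comp_mfderivWithin r (mdifferentiableAt_fst (I := 𝓘(ℝ, ℝ)) (I' := 𝓡 n)) hγ
    hr.uniqueMDiffWithinAt
  rw [mfderivWithin_eq_fderivWithin] at h
  exact (DFunLike.congr_fun h (1 : ℝ)).symm

theorem dSpace_mfderivWithin {γ : ℝ → ℝ × S} {s : Set ℝ} {r : ℝ}
    (hγ : MDifferentiableWithinAt 𝓘(ℝ, ℝ) (𝓘(ℝ, ℝ).prod (𝓡 n)) γ s r)
    (hr : UniqueDiffWithinAt ℝ s r) :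
    dSpace (γ r) (mfderivWithin 𝓘(ℝ, ℝ) (𝓘(ℝ, ℝ).prod (𝓡 n)) γ s r (1 : ℝ)) =
      mfderivWithin 𝓘(ℝ, ℝ) (𝓡 n) (fun r ↦ (γ r).2) s r (1 : ℝ) := by
  have h := mfderiv_comp_mfderivWithin r (mdifferentiableAt_snd (I := 𝓘(ℝ, ℝ)) (I' := 𝓡 n)) hγ
    hr.uniqueMDiffWithinAt
  exact (DFunLike.congr_fun h (1 : ℝ)).symm

variable [IsManifold (𝓡 n) ∞ S] [RiemannianBundle (fun x : S ↦ TangentSpace (𝓡 n) x)]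
    [IsContMDiffRiemannianBundle (𝓡 n) ∞ (EuclideanSpace ℝ (Fin n))
      (fun x : S ↦ TangentSpace (𝓡 n) x)]

theorem isFutureCausal_static_iff {p : ℝ × S} (v : TangentSpace (𝓘(ℝ, ℝ).prod (𝓡 n)) p) :
    (staticSpacetime n S).IsFutureCausal v ↔ 0 < dTime p v ∧ ‖dSpace p v‖ ≤ dTime p v := by
  have hform : ∀ w : TangentSpace (𝓘(ℝ, ℝ).prod (𝓡 n)) p, (staticSpacetime n S).form p w v =
      -(dTime p w * dTime p v) + inner ℝ (dSpace p w) (dSpace p v) := fun w ↦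
    staticForm_apply p w v
  have htime : (staticSpacetime n S).form p ((staticSpacetime n S).timeField p) v =
      -dTime p v := by
    rw [hform]
    change -(dTime p (staticTimeField p) * dTime p v)
      + inner ℝ (dSpace p (staticTimeField p)) (dSpace p v) = _
    rw [dTime_staticTimeField, dSpace_staticTimeField, inner_zero_left]
    ring
  unfold SpacetimeMetric.IsFutureCausal
  rw [htime, hform, real_inner_self_eq_norm_sq]
  constructor
  · rintro ⟨-, h1, h2⟩
    have hpos : 0 < dTime p v := by linarith
    exact ⟨hpos, abs_le_of_sq_le_sq' (by nlinarith) hpos.le |>.2⟩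
  · rintro ⟨h1, h2⟩
    refine ⟨?_, ?_, by linarith⟩
    · rintro rfl
      rw [map_zero] at h1
      exact h1.false
    · have := mul_self_le_mul_self (norm_nonneg (dSpace p v)) h2
      rw [sq]
      linarith

/-- A curve in the static spacetime is future causal iff its time component is increasing at least
as fast as the speed of its space component. -/
theorem isFutureCausalC1On_static_iff {γ : ℝ → ℝ × S} {a b : ℝ} :
    (staticSpacetime n S).IsFutureCausalC1On γ a b ↔ a < b ∧
      ContDiffOn ℝ 1 (fun s ↦ (γ s).1) (Icc a b) ∧
      ContMDiffOn 𝓘(ℝ, ℝ) (𝓡 n) 1 (fun s ↦ (γ s).2) (Icc a b) ∧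
      ∀ s ∈ Icc a b, 0 < derivWithin (fun s ↦ (γ s).1) (Icc a b) s ∧
        ‖(mfderivWithin 𝓘(ℝ, ℝ) (𝓡 n) (fun s ↦ (γ s).2) (Icc a b) s (1 : ℝ) :
          TangentSpace (𝓡 n) (γ s).2)‖ ≤ derivWithin (fun s ↦ (γ s).1) (Icc a b) s := by
  have hvel : a < b → ContMDiffOn 𝓘(ℝ, ℝ) (𝓘(ℝ, ℝ).prod (𝓡 n)) 1 γ (Icc a b) → ∀ s ∈ Icc a b,
      ((staticSpacetime n S).IsFutureCausal
        (mfderivWithin 𝓘(ℝ, ℝ) (𝓘(ℝ, ℝ).prod (𝓡 n)) γ (Icc a b) s (1 : ℝ)) ↔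
      0 < derivWithin (fun s ↦ (γ s).1) (Icc a b) s ∧
        ‖(mfderivWithin 𝓘(ℝ, ℝ) (𝓡 n) (fun s ↦ (γ s).2) (Icc a b) s (1 : ℝ) :
          TangentSpace (𝓡 n) (γ s).2)‖ ≤ derivWithin (fun s ↦ (γ s).1) (Icc a b) s) := by
    intro hab hγ s hs
    have hd := hγ.mdifferentiableOn one_ne_zero s hs
    have hu := uniqueDiffOn_Icc hab s hs
    rw [isFutureCausal_static_iff, dTime_mfderivWithin hd hu, dSpace_mfderivWithin hd hu]
  constructor
  · rintro ⟨hab, hγ, hc⟩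
    exact ⟨hab, contMDiffOn_iff_contDiffOn.1 (contMDiff_fst.comp_contMDiffOn hγ),
      contMDiff_snd.comp_contMDiffOn hγ, fun s hs ↦ (hvel hab hγ s hs).1 (hc s hs)⟩
  · rintro ⟨hab, h1, h2, hc⟩
    have hγ : ContMDiffOn 𝓘(ℝ, ℝ) (𝓘(ℝ, ℝ).prod (𝓡 n)) 1 γ (Icc a b) :=
      (contMDiffOn_iff_contDiffOn.2 h1).prodMk h2
    exact ⟨hab, hγ, fun s hs ↦ (hvel hab hγ s hs).2 (hc s hs)⟩

/-- The space component of a causal curve, parametrized by time, has speed at most one. -/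
theorem exists_isSubunitOn_of_isFutureCausalC1On {γ : ℝ → ℝ × S} {a b : ℝ}
    (h : (staticSpacetime n S).IsFutureCausalC1On γ a b) :
    ∃ c : ℝ → S, IsSubunitOn (n := n) c (γ a).1 (γ b).1 ∧ c (γ a).1 = (γ a).2 ∧
      c (γ b).1 = (γ b).2 := by
  obtain ⟨hab, h1, h2, hc⟩ := isFutureCausalC1On_static_iff.1 h
  exact exists_isSubunitOn_of_norm_mfderivWithin_le hab h1 (fun s hs ↦ (hc s hs).1) h2
    fun s hs ↦ (hc s hs).2

variable (n S) in
theorem isContinuousRiemannianBundle_tangentSpace :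
    IsContinuousRiemannianBundle (EuclideanSpace ℝ (Fin n))
      (fun x : S ↦ TangentSpace (𝓡 n) x) := by
  obtain ⟨g, hg, hgi⟩ := IsContMDiffRiemannianBundle.exists_contMDiff (IB := 𝓡 n) (n := ∞)
    (F := EuclideanSpace ℝ (Fin n)) (E := fun x : S ↦ TangentSpace (𝓡 n) x)
  exact ⟨g, hg.continuous, hgi⟩

/-- A curve of length at most `t₁ - t₀` lifts to a causal curve from time `t₀` to time `t₁`. In the
case of equality the lift is null, and its velocity must not vanish: the curve has to be regular. -/
theorem mem_causalRelation_of_pathELength_le {σ : ℝ → S} {a b t₀ t₁ : ℝ} (hab : a < b)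
    (hσ : ContMDiffOn 𝓘(ℝ, ℝ) (𝓡 n) 1 σ (Icc a b)) (ht : t₀ ≤ t₁)
    (hle : pathELength (𝓡 n) σ a b ≤ ENNReal.ofReal (t₁ - t₀))
    (hlt : pathELength (𝓡 n) σ a b < ENNReal.ofReal (t₁ - t₀) ∨ ∀ s ∈ Icc a b,
      0 < ‖(mfderivWithin 𝓘(ℝ, ℝ) (𝓡 n) σ (Icc a b) s (1 : ℝ) : TangentSpace (𝓡 n) (σ s))‖) :
    ((t₀, σ a), (t₁, σ b)) ∈ (staticSpacetime n S).causalRelation := by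
  have hu := uniqueDiffOn_Icc hab
  set v : ℝ → ℝ := fun s ↦
    ‖(mfderivWithin 𝓘(ℝ, ℝ) (𝓡 n) σ (Icc a b) s (1 : ℝ) : TangentSpace (𝓡 n) (σ s))‖ with hv
  have hvc : ContinuousOn v (Icc a b) := by
    have h1 : Continuous (fun s : ℝ ↦ (⟨s, (1 : ℝ)⟩ : TangentBundle 𝓘(ℝ, ℝ) ℝ)) :=
      (contMDiff_vectorSpace_iff_contDiff (n := 0) (V := fun _ ↦ (1 : ℝ))).2
        contDiff_const |>.continuous
    have h2 : ContinuousOn (fun s ↦ (⟨σ s, mfderivWithin 𝓘(ℝ, ℝ) (𝓡 n) σ (Icc a b) s (1 : ℝ)⟩ :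
        TangentBundle (𝓡 n) S)) (Icc a b) :=
      (hσ.continuousOn_tangentMapWithin le_rfl hu.uniqueMDiffOn).comp h1.continuousOn
        fun s hs ↦ hs
    have := isContinuousRiemannianBundle_tangentSpace n S
    refine ((h2.inner_bundle h2).sqrt).congr fun s _ ↦ ?_
    exact norm_eq_sqrt_real_inner _
  have hlen : pathELength (𝓡 n) σ a b = ENNReal.ofReal (∫ s in a..b, v s) := by
    rw [pathELength_eq_lintegral_mfderivWithin_Icc, intervalIntegral.integral_of_le hab.le,
      ← integral_Icc_eq_integral_Ioc, ofReal_integral_eq_lintegral_ofReal hvc.integrableOn_Icc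
        (Eventually.of_forall fun s ↦ norm_nonneg _)]
    refine lintegral_congr fun s ↦ ?_
    exact (ofReal_norm _).symm
  have hLle : ∫ s in a..b, v s ≤ t₁ - t₀ := by
    rwa [hlen, ENNReal.ofReal_le_ofReal_iff (by linarith)] at hle
  set κ : ℝ := (t₁ - t₀ - ∫ s in a..b, v s) / (b - a) with hκ
  have hκ0 : 0 ≤ κ := div_nonneg (by linarith) (by linarith)
  have hpos : ∀ s ∈ Icc a b, 0 < v s + κ := by
    intro s hs
    rcases hlt with h | h
    · rw [hlen, ENNReal.ofReal_lt_ofReal_iff_of_nonneg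
        (intervalIntegral.integral_nonneg hab.le fun s _ ↦ norm_nonneg _)] at h
      exact add_pos_of_nonneg_of_pos (norm_nonneg _) (div_pos (by linarith) (by linarith))
    · exact add_pos_of_pos_of_nonneg (h s hs) hκ0
  -- The time function is arc length plus a linear term, which uses up the remaining time.
  set w : ℝ → ℝ := fun s ↦ v (projIcc a b hab.le s) + κ with hw
  have hwc : Continuous w := (hvc.comp_continuous (continuous_subtype_val.comp continuous_projIcc)
    fun s ↦ (projIcc a b hab.le s).2).add continuous_const
  have hwv : ∀ s ∈ Icc a b, w s = v s + κ := fun s hs ↦ by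
    simp only [hw]
    rw [projIcc_of_mem hab.le hs]
  set T : ℝ → ℝ := fun s ↦ t₀ + ∫ r in a..s, w r with hT
  have hTd : ∀ s, HasDerivAt T (w s) s := fun s ↦
    (hwc.integral_hasStrictDerivAt a s).hasDerivAt.const_add _
  have hTc : ContDiff ℝ 1 T := contDiff_one_iff_deriv.2
    ⟨fun s ↦ (hTd s).differentiableAt, by rwa [show deriv T = w from funext fun s ↦ (hTd s).deriv]⟩
  have hTb : T b = t₁ := by
    have : ∫ r in a..b, w r = ∫ r in a..b, (v r + κ) := intervalIntegral.integral_congr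
      fun s hs ↦ hwv s (by rwa [uIcc_of_le hab.le] at hs)
    simp only [hT]
    rw [this, intervalIntegral.integral_add (hvc.intervalIntegrable_of_Icc hab.le)
      intervalIntegrable_const, intervalIntegral.integral_const, hκ, smul_eq_mul,
      mul_div_cancel₀ _ (by linarith : b - a ≠ 0)]
    ring
  have hTw : ∀ s ∈ Icc a b, derivWithin T (Icc a b) s = v s + κ := fun s hs ↦ by
    rw [(hTd s).hasDerivWithinAt.derivWithin (hu s hs), hwv s hs]
  refine Or.inr ⟨fun s ↦ (T s, σ s), a, b, ⟨1, fun i ↦ if i = 0 then a else b, one_pos, by simp,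
    by simp, fun i hi ↦ ?_⟩, by simp [hT], by simp [hTb]⟩
  obtain rfl : i = 0 := by omega
  simp only [if_true, zero_add, one_ne_zero, if_false]
  refine isFutureCausalC1On_static_iff.2 ⟨hab, hTc.contDiffOn, hσ, fun s hs ↦ ?_⟩
  simp only
  rw [hTw s hs]
  exact ⟨hpos s hs, le_add_of_nonneg_right hκ0⟩

theorem mem_causalRelation_of_riemannianEDist_lt {x y : S} {t₀ t₁ : ℝ}
    (h : riemannianEDist (𝓡 n) x y < ENNReal.ofReal (t₁ - t₀)) :
    ((t₀, x), (t₁, y)) ∈ (staticSpacetime n S).causalRelation := by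
  obtain ⟨σ, rfl, rfl, hσ, hlen⟩ := exists_lt_of_riemannianEDist_lt h
  have ht : 0 < t₁ - t₀ := ENNReal.ofReal_pos.1 (bot_le.trans_lt h)
  exact mem_causalRelation_of_pathELength_le zero_lt_one hσ (by linarith) hlen.le (Or.inl hlen)

end StaticCausality

/-! ### Convexity and causal simplicity -/

section Convexity

open MeasureTheory Manifold Filter

variable {n : ℕ} {S : Type*} [TopologicalSpace S] [ChartedSpace (EuclideanSpace ℝ (Fin n)) S]
  [IsManifold (𝓡 n) ∞ S] [RiemannianBundle (fun x : S ↦ TangentSpace (𝓡 n) x)]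
  [IsContMDiffRiemannianBundle (𝓡 n) ∞ (EuclideanSpace ℝ (Fin n))
    (fun x : S ↦ TangentSpace (𝓡 n) x)]

/-- Along a causal curve, the elapsed time between two corners is positive and bounds the distance
between their space components. -/
theorem fst_lt_and_riemannianEDist_le_of_pieces {γ : ℝ → ℝ × S} {τ : ℕ → ℝ} {k : ℕ}
    (h : ∀ i < k, (staticSpacetime n S).IsFutureCausalC1On γ (τ i) (τ (i + 1))) {i j : ℕ}
    (hij : i ≤ j) (hj : j ≤ k) :
    (γ (τ i)).1 ≤ (γ (τ j)).1 ∧ (i < j → (γ (τ i)).1 < (γ (τ j)).1) ∧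
      riemannianEDist (𝓡 n) (γ (τ i)).2 (γ (τ j)).2 ≤
        ENNReal.ofReal ((γ (τ j)).1 - (γ (τ i)).1) := by
  induction j, hij using Nat.le_induction with
  | base => simp [riemannianEDist_self]
  | succ j hij ih =>
    obtain ⟨h1, -, h2⟩ := ih (by omega)
    obtain ⟨c, hc, c0, c1⟩ := exists_isSubunitOn_of_isFutureCausalC1On (h j (by omega))
    have hlt := hc.lt
    have h3 := hc.riemannianEDist_le le_rfl hlt.le le_rfl
    rw [c0, c1] at h3
    refine ⟨h1.trans hlt.le, fun _ ↦ h1.trans_lt hlt,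
      riemannianEDist_triangle.trans ((add_le_add h2 h3).trans_eq ?_)⟩
    rw [← ENNReal.ofReal_add (by linarith) (by linarith)]
    congr 1
    ring

theorem fst_lt_of_isFutureCausalCurve {γ : ℝ → ℝ × S} {a b : ℝ}
    (h : (staticSpacetime n S).IsFutureCausalCurve γ a b) : (γ a).1 < (γ b).1 := by
  obtain ⟨k, τ, hk, rfl, rfl, hτ⟩ := h
  exact (fst_lt_and_riemannianEDist_le_of_pieces hτ hk.le le_rfl).2.1 hk

theorem le_and_riemannianEDist_le_of_mem_causalRelation {p q : ℝ × S}
    (h : (p, q) ∈ (staticSpacetime n S).causalRelation) :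
    p.1 ≤ q.1 ∧ riemannianEDist (𝓡 n) p.2 q.2 ≤ ENNReal.ofReal (q.1 - p.1) := by
  rcases h with h | ⟨γ, a, b, ⟨k, τ, hk, rfl, rfl, hτ⟩, h0, h1⟩
  · obtain rfl : p = q := h
    simp [riemannianEDist_self]
  · obtain rfl : γ (τ 0) = p := h0
    obtain rfl : γ (τ k) = q := h1
    have := fst_lt_and_riemannianEDist_le_of_pieces hτ hk.le le_rfl
    exact ⟨this.1, this.2.2⟩

/-- A causal curve which goes from `x` to `y` in the least possible time projects, when parametrized
by time, to a minimizing geodesic. -/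
theorem exists_isMinimizingGeodesicOn_of_isFutureCausalCurve {γ : ℝ → ℝ × S} {a b : ℝ}
    (h : (staticSpacetime n S).IsFutureCausalCurve γ a b)
    (hd : ENNReal.ofReal ((γ b).1 - (γ a).1) ≤ riemannianEDist (𝓡 n) (γ a).2 (γ b).2) :
    ∃ c : ℝ → S, c (γ a).1 = (γ a).2 ∧ c (γ b).1 = (γ b).2 ∧
      IsMinimizingGeodesicOn (n := n) c (γ a).1 (γ b).1 := by
  obtain ⟨k, τ, hk, rfl, rfl, hτ⟩ := h
  -- Concatenate the projected pieces one by one; `IsSubunitOn.union` removes each corner.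
  have key : ∀ j, 1 ≤ j → j ≤ k → ∃ c : ℝ → S,
      IsSubunitOn (n := n) c (γ (τ 0)).1 (γ (τ j)).1 ∧ c (γ (τ 0)).1 = (γ (τ 0)).2 ∧
        c (γ (τ j)).1 = (γ (τ j)).2 := by
    intro j hj
    induction j, hj using Nat.le_induction with
    | base => exact fun hj ↦ exists_isSubunitOn_of_isFutureCausalC1On (hτ 0 hk)
    | succ j hj ih =>
      intro hjk
      obtain ⟨c₁, hc₁, h0, h1⟩ := ih (by omega)
      obtain ⟨c₂, hc₂, h1', h2⟩ := exists_isSubunitOn_of_isFutureCausalC1On (hτ j (by omega))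
      set c : ℝ → S := fun s ↦ if s ≤ (γ (τ j)).1 then c₁ s else c₂ s with hc
      have e₁ : EqOn c c₁ (Icc (γ (τ 0)).1 (γ (τ j)).1) := fun s hs ↦ if_pos hs.2
      have e₂ : EqOn c c₂ (Icc (γ (τ j)).1 (γ (τ (j + 1))).1) := fun s hs ↦ by
        rcases hs.1.eq_or_lt with rfl | h
        · rw [h1', ← h1]; exact if_pos le_rfl
        · exact if_neg (not_le.2 h)
      have hca : c (γ (τ 0)).1 = (γ (τ 0)).2 := (e₁ (left_mem_Icc.2 hc₁.lt.le)).trans h0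
      have hcb : c (γ (τ (j + 1))).1 = (γ (τ (j + 1))).2 :=
        (e₂ (right_mem_Icc.2 hc₂.lt.le)).trans h2
      refine ⟨c, (hc₁.congr e₁).union (hc₂.congr e₂) ?_, hca, hcb⟩
      have hrest := fst_lt_and_riemannianEDist_le_of_pieces hτ hjk le_rfl
      rw [hca, hcb]
      refine ofReal_le_riemannianEDist_of_subsegment (r := 0)
        (t := (γ (τ k)).1 - (γ (τ (j + 1))).1) le_rfl (by linarith [hc₁.lt, hc₂.lt])
        (by linarith [hrest.1]) (x := (γ (τ 0)).2) (w := (γ (τ k)).2) ?_ hrest.2.2 ?_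
      · rw [riemannianEDist_self]; exact zero_le
      · refine (ENNReal.ofReal_le_ofReal (le_of_eq ?_)).trans hd
        ring
  obtain ⟨c, hc, h0, h1⟩ := key k hk le_rfl
  exact ⟨c, h0, h1, hc.isMinimizingGeodesicOn (by rwa [h0, h1])⟩

set_option maxSynthPendingDepth 3 in
theorem isMinimizingGeodesicOn_const (x : S) :
    IsMinimizingGeodesicOn (n := n) (fun _ : ℝ ↦ x) 0 1 := by
  refine ⟨⟨zero_lt_one, contMDiffOn_const, fun s _ ↦ ?_⟩, ?_⟩
  · intro c c' c'' z
    have h1 : c' = 0 := by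
      ext1 r
      exact congrFun (derivWithin_fun_const _ _) r
    have h2 : c'' = 0 := by
      ext1 r
      simp only [c'', h1]
      exact congrFun (derivWithin_const _ _) r
    rw [h2, h1, christoffelInChart_self _ (mem_extChartAt_target x), ← chartMetric_apply,
      fderivQuadratic_apply]
    simp
  · rw [riemannianEDist_self]
    refine le_antisymm ?_ bot_le
    rw [pathELength_eq_lintegral_mfderivWithin_Icc]
    simp [mfderivWithin_const]

variable [T2Space S]

variable (n S) in
theorem continuous_riemannianEDist :
    Continuous fun p : S × S ↦ riemannianEDist (𝓡 n) p.1 p.2 := by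
  have := isContinuousRiemannianBundle_tangentSpace n S
  have := ChartedSpace.locallyCompactSpace (EuclideanSpace ℝ (Fin n)) S
  let _ : PseudoEMetricSpace S := PseudoEMetricSpace.ofRiemannianMetric (𝓡 n) S
  exact continuous_edist

theorem eq_of_riemannianEDist_eq_zero {x y : S} (h : riemannianEDist (𝓡 n) x y = 0) : x = y := by
  have := isContinuousRiemannianBundle_tangentSpace n S
  have := ChartedSpace.locallyCompactSpace (EuclideanSpace ℝ (Fin n)) S
  let _ : EMetricSpace S := EMetricSpace.ofRiemannianMetric (𝓡 n) S
  exact edist_eq_zero.1 h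

variable (n) in
theorem riemannianEDist_lt_top [ConnectedSpace S] (x y : S) : riemannianEDist (𝓡 n) x y < ⊤ := by
  have := isContinuousRiemannianBundle_tangentSpace n S
  have := ChartedSpace.locallyCompactSpace (EuclideanSpace ℝ (Fin n)) S
  let _ : PseudoEMetricSpace S := PseudoEMetricSpace.ofRiemannianMetric (𝓡 n) S
  have hclopen : IsClopen (Metric.eball y ⊤) := ⟨Metric.isClosed_eball_top, Metric.isOpen_eball⟩
  have huniv := hclopen.eq_univ ⟨y, Metric.mem_eball_self ENNReal.coe_lt_top⟩
  exact huniv.ge (mem_univ x)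

/-- On a convex Riemannian manifold, the causal relation is given by the Riemannian distance. -/
theorem mem_causalRelation_iff_of_isConvexRiemannian (hS : IsConvexRiemannian n S) (p q : ℝ × S) :
    (p, q) ∈ (staticSpacetime n S).causalRelation ↔
      p.1 ≤ q.1 ∧ riemannianEDist (𝓡 n) p.2 q.2 ≤ ENNReal.ofReal (q.1 - p.1) := by
  refine ⟨le_and_riemannianEDist_le_of_mem_causalRelation, fun ⟨ht, hd⟩ ↦ ?_⟩
  obtain ⟨t₀, x⟩ := p
  obtain ⟨t₁, y⟩ := q
  simp only at ht hd
  rcases ht.eq_or_lt with rfl | hlt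
  · rw [sub_self, ENNReal.ofReal_zero] at hd
    rw [eq_of_riemannianEDist_eq_zero (le_antisymm hd bot_le)]
    exact Or.inl rfl
  · obtain ⟨σ, a, b, rfl, rfl, hgeo, hlen⟩ := hS x y
    rw [← hlen] at hd
    have hσ : ContMDiffOn 𝓘(ℝ, ℝ) (𝓡 n) 1 σ (Icc a b) := hgeo.contMDiffOn.of_le one_le_two
    refine mem_causalRelation_of_pathELength_le hgeo.lt hσ ht hd ?_
    rcases hd.lt_or_eq with h | h
    · exact Or.inl h
    -- The lift is null: the constant speed of the geodesic is nonzero, as its length is positive.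
    · obtain ⟨k, hk⟩ := hgeo.exists_norm_mfderivWithin_eq
      refine Or.inr fun s hs ↦ (norm_nonneg _).lt_of_ne' fun h0 ↦ ?_
      have hk0 : k = 0 := by rw [← hk s hs, h0]
      have : pathELength (𝓡 n) σ a b = 0 := by
        rw [pathELength_eq_lintegral_mfderivWithin_Icc]
        rw [setLIntegral_congr_fun (g := fun _ ↦ 0) measurableSet_Icc fun r hr ↦ ?_]
        · simp
        · rw [← ofReal_norm]
          exact (congrArg ENNReal.ofReal ((hk r hr).trans hk0)).trans ENNReal.ofReal_zero
      rw [this] at h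
      exact (ENNReal.ofReal_pos.2 (sub_pos.2 hlt)).ne h

end Convexity

theorem mainTheorem5 (n : ℕ) (hn : 2 ≤ n) (S : Type*) [TopologicalSpace S] [T2Space S]
    [SecondCountableTopology S] [ConnectedSpace S]
    [ChartedSpace (EuclideanSpace ℝ (Fin n)) S] [IsManifold (𝓡 n) ∞ S]
    [RiemannianBundle (fun x : S ↦ TangentSpace (𝓡 n) x)]
    [IsContMDiffRiemannianBundle (𝓡 n) ∞ (EuclideanSpace ℝ (Fin n))
      (fun x : S ↦ TangentSpace (𝓡 n) x)] :
    IsConvexRiemannian n S ↔ (staticSpacetime n S).IsCausallySimple := by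
  constructor
  · intro hS
    refine ⟨fun ⟨γ, a, b, h, hab⟩ ↦ ?_, ?_⟩
    · exact (fst_lt_of_isFutureCausalCurve h).ne (congrArg Prod.fst hab)
    · have heq : (staticSpacetime n S).causalRelation = {pq | pq.1.1 ≤ pq.2.1 ∧
          Manifold.riemannianEDist (𝓡 n) pq.1.2 pq.2.2 ≤ ENNReal.ofReal (pq.2.1 - pq.1.1)} := by
        ext ⟨p, q⟩
        exact mem_causalRelation_iff_of_isConvexRiemannian hS p q
      rw [heq]
      have h1 : IsClosed {pq : (ℝ × S) × (ℝ × S) | pq.1.1 ≤ pq.2.1} :=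
        isClosed_le (by fun_prop) (by fun_prop)
      have h2 : IsClosed {pq : (ℝ × S) × (ℝ × S) |
          Manifold.riemannianEDist (𝓡 n) pq.1.2 pq.2.2 ≤ ENNReal.ofReal (pq.2.1 - pq.1.1)} :=
        isClosed_le ((continuous_riemannianEDist n S).comp (f := fun pq : (ℝ × S) × (ℝ × S) ↦
          (pq.1.2, pq.2.2)) (by fun_prop)) (ENNReal.continuous_ofReal.comp (by fun_prop))
      exact h1.inter h2
  · rintro ⟨-, hJ⟩ x y
    obtain ⟨d, hd0, hd⟩ : ∃ d : ℝ, 0 ≤ d ∧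
        Manifold.riemannianEDist (𝓡 n) x y = ENNReal.ofReal d :=
      ⟨_, ENNReal.toReal_nonneg, (ENNReal.ofReal_toReal (riemannianEDist_lt_top n x y).ne).symm⟩
    -- `(t, y)` lies in the causal future of `(0, x)` for all `t > d`; let `t` tend to `d`.
    have hmem : (((0 : ℝ), x), (d, y)) ∈ (staticSpacetime n S).causalRelation := by
      have hlim : Filter.Tendsto (fun t : ℝ ↦ (((0 : ℝ), x), (t, y))) (𝓝[>] d)
          (𝓝 (((0 : ℝ), x), (d, y))) :=
        (Continuous.tendsto (by fun_prop) d).mono_left nhdsWithin_le_nhds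
      refine hJ.mem_of_tendsto hlim ?_
      filter_upwards [self_mem_nhdsWithin] with t ht
      refine mem_causalRelation_of_riemannianEDist_lt ?_
      rw [hd, sub_zero]
      exact (ENNReal.ofReal_lt_ofReal_iff_of_nonneg hd0).2 ht
    rcases hmem with h | ⟨γ, a, b, hγ, ha, hb⟩
    · obtain rfl : x = y := congrArg Prod.snd h
      exact ⟨_, 0, 1, rfl, rfl, isMinimizingGeodesicOn_const x⟩
    · obtain ⟨c, h0, h1, hc⟩ := exists_isMinimizingGeodesicOn_of_isFutureCausalCurve hγ (by
        rw [ha, hb]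
        simp [hd])
      rw [ha] at h0
      rw [hb] at h1
      exact ⟨c, _, _, h0, h1, by rwa [ha, hb] at hc⟩
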